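/- Let $L(z)=\sum_{i\ge 2}L_iz^i$ and $R(z)=\sum_{i\ge 1}R_iz^i$ be polynomials with non-negative real coefficients and $L(1)=R(1)=1$ (the node degree distributions of an LDPC ensemble), and put $\lambda(z)=L'(z)/L'(1)$, $\rho(z)=R'(z)/R'(1)$, $r=1-L'(1)/R'(1)$. Let $\phi\colon[0,1]\times[0,1]\to[0,1]$, $(x,\epsilon)\mapsto\phi(x;\epsilon)$ (the extrinsic erasure rate of the channel detector), and put $$f(x;\epsilon)=\phi(L(x);\epsilon)\lambda(x),\quad g(x)=1-\rho(1-x),\quad h(x;\epsilon)=f(g(x);\epsilon),$$ $$U(x;\epsilon)=xg(x)-\int_0^xg(z)\,dz-\int_0^{g(x)}f(z;\epsilon)\,dz .$$ Let $\overline{x}^*(\epsilon)$ be the largest minimizer of $U(\cdot;\epsilon)$ over $[0,1]$, and call $0$ stable at $\epsilon$ if there is $\delta>0$ with $h(x;\epsilon)<x$ for all $x\in(0,\delta]$. The potential threshold and the stability threshold are $$\epsilon_c^*=\sup\{\epsilon\in[0,1]\mid \overline{x}^*(\epsilon)=0\},\qquad \epsilon_{\mathrm{stab}}^*=\sup\{\epsilon\in[0,1]\mid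 0\text{ is stable at }\epsilon\}.$$ Let $\mathcal X_f=\{x\in(0,1]\mid h(x;0)\le x\le h(x;1)\}$; for $x\in\mathcal X_f$ let $\epsilon(x)$ be the smallest $\epsilon\in[0,1]$ with $h(x;\epsilon)=x$, and let $P(x)=-L'(1)\,U(x;\epsilon(x))$ be the trial entropy. With the conventions $P(0)=0$ and $\epsilon(0)=\epsilon_{\mathrm{stab}}^*$, the generalized Maxwell threshold is $$\epsilon^{\mathrm{Max}}=\min\{\epsilon(x)\mid x\in\mathcal X_f\cup\{0\},\ P(x)=0\}.$$ Assume that 1. $r>0$; 2. $\phi$ is $C^1$ on $[0,1]\times[0,1]$; 3. $x\mapsto f(x;\epsilon)$ is non-decreasing on $[0,1]$ for every $\epsilon\in[0,1]$ (for example because $\phi(\cdot;\epsilon)$ is); 4. for every $x\in(0,1]$ the function $\epsilon\mapsto\phi(x;\epsilon)$ is strictly increasing on $[0,1]$ (for example because $\partial\phi/\partial\epsilon>0$); 5. $\epsilon\mapsto\phi'(0;\epsilon)$ (the derivative in $x$) or $\epsilon\mapsto\phi(0;\epsilon)$ is strictly increasing on $[0,1]$; 6. $\phi(1;1)=1$;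 7. the two thresholds $\epsilon_c^*,\epsilon_{\mathrm{stab}}^*$ are well-defined, i.e. $\overline{x}^*(0)=0$ and $0$ is stable at $\epsilon=0$. Then the minimum defining $\epsilon^{\mathrm{Max}}$ is attained and $\epsilon_c^*=\epsilon^{\mathrm{Max}}$. Consequently, for every $\epsilon\in[0,1]$ with $\epsilon<\epsilon^{\mathrm{Max}}$ there is $w_0<\infty$ such that for all integers $w>w_0$ and all $N\ge1$ the spatially coupled density-evolution recursion $$x_i^{(0)}=1,\qquad x_i^{(\ell+1)}=\sum_{j=1}^{N}A_{j,i}\,f\Big(\sum_{k=1}^{N+w-1}A_{j,k}\,g\big(x_k^{(\ell)}\big);\epsilon\Big),\qquad 1\le i\le N+w-1,$$ where $A_{j,k}=1/w$ if $1\le k-j+1\le w$ and $A_{j,k}=0$ otherwise, satisfies $x_i^{(\ell)}\to0$ as $\ell\to\infty$ for every $i$. -/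

import Mathlib

open Set Filter Topology

namespace SpatialCoupling

/-! ### Parametrized scalar recursions on `[0, 1]`, with parameter in `[0, 1]` -/

/-- The overall update `h(x; ε) = f(g(x; ε); ε)` of the uncoupled recursion. -/
def update (f g : ℝ → ℝ → ℝ) (x ε : ℝ) : ℝ := f (g x ε) ε

/-- The uncoupled potential `U(x; ε) = x g(x; ε) - G(x; ε) - F(g(x; ε); ε)`, where
`F(y; ε) = ∫₀^y f(z; ε) dz` and `G(x; ε) = ∫₀^x g(z; ε) dz`. -/
noncomputable def potential (f g : ℝ → ℝ → ℝ) (x ε : ℝ) : ℝ :=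
  x * g x ε - (∫ z in (0 : ℝ)..x, g z ε) - ∫ z in (0 : ℝ)..(g x ε), f z ε

/-- The set of minimizers over `[0, 1]` of the potential at parameter `ε`. -/
def minimizers (f g : ℝ → ℝ → ℝ) (ε : ℝ) : Set ℝ :=
  {x | x ∈ Icc (0 : ℝ) 1 ∧ ∀ z ∈ Icc (0 : ℝ) 1, potential f g x ε ≤ potential f g z ε}

/-- The largest minimizer of the potential at parameter `ε`. When the potential is continuous in
`x`, the set of minimizers is compact and nonempty, so that its supremum is its maximum. -/
noncomputable def maxMinimizer (f g : ℝ → ℝ → ℝ) (ε : ℝ) : ℝ := sSup (minimizers f g ε)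

/-- The potential threshold (coupled threshold). -/
noncomputable def potentialThreshold (f g : ℝ → ℝ → ℝ) : ℝ :=
  sSup {ε | ε ∈ Icc (0 : ℝ) 1 ∧ maxMinimizer f g ε = 0}

/-- The uncoupled recursion at parameter `ε` is stable at `0`: `h(x; ε) < x` for all sufficiently
small `x > 0`. -/
def StableAtZero (f g : ℝ → ℝ → ℝ) (ε : ℝ) : Prop :=
  ∃ δ ∈ Ioc (0 : ℝ) 1, ∀ x ∈ Ioc (0 : ℝ) δ, update f g x ε < x

/-- The stability threshold. -/
noncomputable def stabilityThreshold (f g : ℝ → ℝ → ℝ) : ℝ :=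
  sSup {ε | ε ∈ Icc (0 : ℝ) 1 ∧ StableAtZero f g ε}

/-- The set of the `x ∈ (0, 1]` that can be a fixed point for some parameter in `[0, 1]`. -/
def fixedPointSupport (f g : ℝ → ℝ → ℝ) : Set ℝ :=
  {x | x ∈ Ioc (0 : ℝ) 1 ∧ update f g x 0 ≤ x ∧ x ≤ update f g x 1}

/-- `ε(x)`: the smallest parameter in `[0, 1]` for which `x` is a fixed point. -/
noncomputable def fixedPointParam (f g : ℝ → ℝ → ℝ) (x : ℝ) : ℝ :=
  sInf {ε | ε ∈ Icc (0 : ℝ) 1 ∧ update f g x ε = x}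

/-- The fixed-point potential `Q(x) = U(x; ε(x))`. -/
noncomputable def fixedPointPotential (f g : ℝ → ℝ → ℝ) (x : ℝ) : ℝ :=
  potential f g x (fixedPointParam f g x)

/-! ### The coupled recursion -/

/-- The `N × (N + w - 1)` coupling matrix. Indices start at `0`, so the condition
`1 ≤ k - j + 1 ≤ w` reads `j ≤ k < j + w`. -/
noncomputable def couplingMatrix (N w : ℕ) : Matrix (Fin N) (Fin (N + w - 1)) ℝ :=
  fun j k => if (j : ℕ) ≤ (k : ℕ) ∧ (k : ℕ) < (j : ℕ) + w then 1 / (w : ℝ) else 0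

/-- The coupled recursion with `N` and coupling width `w` at parameter `ε`, started from the
all-ones vector. -/
noncomputable def coupledSeq (f g : ℝ → ℝ → ℝ) (ε : ℝ) (N w : ℕ) :
    ℕ → Fin (N + w - 1) → ℝ
  | 0 => fun _ => 1
  | l + 1 => fun i => ∑ j : Fin N, couplingMatrix N w j i *
      f (∑ k : Fin (N + w - 1), couplingMatrix N w j k * g (coupledSeq f g ε N w l k) ε) ε

/-! ### LDPC ensembles on channels with erasure noise -/

/-- The degree distributions of an irregular LDPC ensemble, from the node perspective:
`L(z) = ∑_{i ≥ 2} L_i z^i` for the variable nodes and `R(z) = ∑_{i ≥ 1} R_i z^i` for the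
check nodes. -/
structure LDPCEnsemble where
  L : Polynomial ℝ
  R : Polynomial ℝ
  L_nonneg : ∀ i, 0 ≤ L.coeff i
  R_nonneg : ∀ i, 0 ≤ R.coeff i
  L_sum : L.eval 1 = 1
  R_sum : R.eval 1 = 1
  L_zero : L.coeff 0 = 0
  L_one : L.coeff 1 = 0
  R_zero : R.coeff 0 = 0

namespace LDPCEnsemble

/-- `L'(1)`, the average variable-node degree. -/
noncomputable def avgL (C : LDPCEnsemble) : ℝ := C.L.derivative.eval 1

/-- `R'(1)`, the average check-node degree. -/
noncomputable def avgR (C : LDPCEnsemble) : ℝ := C.R.derivative.eval 1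

/-- The code rate `r = 1 - L'(1) / R'(1)`. -/
noncomputable def rate (C : LDPCEnsemble) : ℝ := 1 - C.avgL / C.avgR

/-- The edge degree distribution `λ(z) = L'(z) / L'(1)`. -/
noncomputable def edgeL (C : LDPCEnsemble) (z : ℝ) : ℝ := C.L.derivative.eval z / C.avgL

/-- The edge degree distribution `ρ(z) = R'(z) / R'(1)`. -/
noncomputable def edgeR (C : LDPCEnsemble) (z : ℝ) : ℝ := C.R.derivative.eval z / C.avgR

/-- The density-evolution function `f(x; ε) = φ(L(x); ε) λ(x)` of the ensemble on the channel
whose detector has extrinsic erasure rate `φ`. -/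
noncomputable def deF (C : LDPCEnsemble) (φ : ℝ → ℝ → ℝ) (x ε : ℝ) : ℝ :=
  φ (C.L.eval x) ε * C.edgeL x

/-- The density-evolution function `g(x; ε) = 1 - ρ(1 - x)`. -/
noncomputable def deG (C : LDPCEnsemble) (x _ε : ℝ) : ℝ := 1 - C.edgeR (1 - x)

/-- The trial entropy `P(x) = -L'(1) Q(x)`. -/
noncomputable def trialEntropy (C : LDPCEnsemble) (φ : ℝ → ℝ → ℝ) (x : ℝ) : ℝ :=
  -C.avgL * fixedPointPotential (C.deF φ) C.deG x

/-- The values `ε(x)` at the roots `x` of the trial entropy, together with the stability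
threshold, which is the value `ε(0)` at the root `0`. -/
noncomputable def maxwellValues (C : LDPCEnsemble) (φ : ℝ → ℝ → ℝ) : Set ℝ :=
  insert (stabilityThreshold (C.deF φ) C.deG)
    {e | ∃ x ∈ fixedPointSupport (C.deF φ) C.deG,
      C.trialEntropy φ x = 0 ∧ e = fixedPointParam (C.deF φ) C.deG x}

/-- The generalized Maxwell threshold. -/
noncomputable def maxwellThreshold (C : LDPCEnsemble) (φ : ℝ → ℝ → ℝ) : ℝ :=
  sInf (C.maxwellValues φ)

end LDPCEnsemble

end SpatialCoupling

/-! Equality of thresholds. Write ε_c, ε_stab for the potential and stability thresholds. Since U(0)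
= 0, a zero largest minimizer means U > 0 on (0,1]. As U decreases in ε, this holds for every ε <
ε_c, so a positive root x of P cannot have ε(x) < ε_c. The other lower bound needed is ε_c ≤ ε_stab
(`potentialThreshold_le_stabilityThreshold`). For attainment: if ε_c = ε_stab, the root 0 serves. If
ε_c < ε_stab, stability keeps U positive on some (0,δ] slightly beyond ε_c, so positivity must fail
on [δ,1]: U(·;ε_c) ≥ 0 vanishes at some m ≥ δ. Because U' = (x - h) g' with g' > 0 on (0,1), this
minimizer is a fixed point, hence ε(m) = ε_c and P(m) = 0.

The delicate point in ε_c ≤ ε_stab is that instability only gives h(x) ≥ x for some x arbitrarily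
close to 0, while making U negative needs an interval. Between two parameters φ is separated near 0
by a polynomial; with it in place of φ, h(x) - x becomes a polynomial, whose sign just right of 0 is
constant (`eventually_lt_update_of_polynomial`).

Convergence. The finite chain is dominated by a half-infinite one, which decreases to a
nondecreasing fixed point with supremum s. Monotonicity gives s ≤ h(s), and summation by parts gives
U(s) ≤ 1/w (`potential_le_of_chainStep_eq`). Once 1/w is below the minimum of U on [δ,1], s ≤ δ, and
stability forces s = 0. -/

namespace SpatialCoupling

/-! ### The half-infinite coupled chain -/

/-- Average of `a` over the window of length `w` starting at `j`. -/
noncomputable def forwardAverage (w : ℕ) (a : ℕ → ℝ) (j : ℕ) : ℝ :=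
  (∑ k ∈ Finset.range w, a (j + k)) / w

/-- The value at the `k`-th position before `i`, extended by zero. -/
noncomputable def pastValue (b : ℕ → ℝ) (i k : ℕ) : ℝ := if k ≤ i then b (i - k) else 0

/-- Average of `b` over the window of length `w` ending at `i`, with `b` extended by zero. -/
noncomputable def backwardAverage (w : ℕ) (b : ℕ → ℝ) (i : ℕ) : ℝ :=
  (∑ k ∈ Finset.range w, pastValue b i k) / w

/-- One step of the coupled recursion on the half-infinite chain. -/
noncomputable def chainStep (f g : ℝ → ℝ) (w : ℕ) (x : ℕ → ℝ) : ℕ → ℝ :=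
  backwardAverage w fun j => f (forwardAverage w (fun i => g (x i)) j)

/-- The coupled recursion on the half-infinite chain, started from the all-ones sequence. -/
noncomputable def chainSeq (f g : ℝ → ℝ) (w : ℕ) : ℕ → ℕ → ℝ
  | 0 => fun _ => 1
  | l + 1 => chainStep f g w (chainSeq f g w l)

/-! ### Window averages and their adjointness. -/

section Averages

variable {w : ℕ} {a b : ℕ → ℝ}

theorem forwardAverage_le_forwardAverage {i j : ℕ} (h : ∀ k < w, a (i + k) ≤ b (j + k)) :
    forwardAverage w a i ≤ forwardAverage w b j := by
  unfold forwardAverage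
  gcongr with k hk
  exact h k (Finset.mem_range.1 hk)

theorem forwardAverage_mem_Icc (hw : 0 < w) {c d : ℝ} {j : ℕ}
    (h : ∀ k < w, a (j + k) ∈ Icc c d) : forwardAverage w a j ∈ Icc c d := by
  have hw' : (0 : ℝ) < w := by exact_mod_cast hw
  unfold forwardAverage
  constructor
  · rw [le_div_iff₀ hw']
    have := Finset.card_nsmul_le_sum (Finset.range w) (fun k => a (j + k)) c
      fun k hk => (h k (Finset.mem_range.1 hk)).1
    simpa [mul_comm] using this
  · rw [div_le_iff₀ hw']
    have := Finset.sum_le_card_nsmul (Finset.range w) (fun k => a (j + k)) d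
      fun k hk => (h k (Finset.mem_range.1 hk)).2
    simpa [mul_comm] using this

theorem pastValue_nonneg (hb : ∀ j, 0 ≤ b j) (i k : ℕ) : 0 ≤ pastValue b i k := by
  unfold pastValue
  split_ifs
  exacts [hb _, le_rfl]

theorem pastValue_mono (hb : Monotone b) (hb0 : ∀ j, 0 ≤ b j) (k : ℕ) :
    Monotone fun i => pastValue b i k := by
  intro i j hij
  unfold pastValue
  by_cases hi : k ≤ i
  · simpa [hi, hi.trans hij] using hb (by omega)
  · beta_reduce
    rw [if_neg hi]
    exact pastValue_nonneg hb0 j k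

theorem backwardAverage_nonneg (hb : ∀ j, 0 ≤ b j) (i : ℕ) : 0 ≤ backwardAverage w b i :=
  div_nonneg (Finset.sum_nonneg fun k _ => pastValue_nonneg hb i k) (Nat.cast_nonneg w)

theorem backwardAverage_mono (hb : Monotone b) (hb0 : ∀ j, 0 ≤ b j) :
    Monotone (backwardAverage w b) := by
  intro i j hij
  unfold backwardAverage
  gcongr with k hk
  exact pastValue_mono hb hb0 k hij

theorem backwardAverage_le_backwardAverage (h : ∀ j, a j ≤ b j) (i : ℕ) :
    backwardAverage w a i ≤ backwardAverage w b i := by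
  unfold backwardAverage
  gcongr with k hk
  unfold pastValue
  split_ifs
  exacts [h _, le_rfl]

theorem backwardAverage_le (hw : 0 < w) {d : ℝ} {i : ℕ} (hd : 0 ≤ d) (h : ∀ j ≤ i, b j ≤ d) :
    backwardAverage w b i ≤ d := by
  have hw' : (0 : ℝ) < w := by exact_mod_cast hw
  unfold backwardAverage
  rw [div_le_iff₀ hw']
  have := Finset.sum_le_card_nsmul (Finset.range w) (fun k => pastValue b i k) d
    fun k _ => by
      unfold pastValue
      split_ifs
      exacts [h _ (Nat.sub_le _ _), hd]
  simpa [mul_comm] using this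

/-- Moving the window one place right admits only the term `b (i + 1)` and drops a nonnegative one.
For a fixed point of the chain this bounds consecutive increments by 1/w. -/
theorem backwardAverage_succ_le (hb0 : ∀ j, 0 ≤ b j) (i : ℕ) :
    backwardAverage w b (i + 1) ≤ backwardAverage w b i + b (i + 1) / w := by
  unfold backwardAverage
  rw [← add_div]
  gcongr
  have h1 : ∑ k ∈ Finset.range w, pastValue b (i + 1) k
      ≤ ∑ k ∈ Finset.range (w + 1), pastValue b (i + 1) k :=
    Finset.sum_le_sum_of_subset_of_nonneg (Finset.range_mono (Nat.le_succ w))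
      fun k _ _ => pastValue_nonneg hb0 _ k
  refine h1.trans_eq ?_
  rw [Finset.sum_range_succ']
  simp [pastValue]

/-- All terms but `k = 0` lie before the chain and vanish. Enlarging the range to `w + 1` lets that
term be split off without excluding `w = 0`. -/
theorem backwardAverage_zero_le (hb0 : ∀ j, 0 ≤ b j) :
    backwardAverage w b 0 ≤ b 0 / w := by
  unfold backwardAverage
  gcongr
  have h1 : ∑ k ∈ Finset.range w, pastValue b 0 k ≤ ∑ k ∈ Finset.range (w + 1), pastValue b 0 k :=
    Finset.sum_le_sum_of_subset_of_nonneg (Finset.range_mono (Nat.le_succ w))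
      fun k _ _ => pastValue_nonneg hb0 _ k
  refine h1.trans_eq ?_
  rw [Finset.sum_range_succ']
  simp [pastValue]

/-- Summation by parts: the two averages are adjoint to each other, up to boundary terms. -/
theorem sum_backwardAverage_mul_sub_le (ha : Monotone a) (hb0 : ∀ j, 0 ≤ b j) (n : ℕ) :
    ∑ i ∈ Finset.range n, backwardAverage w b i * (a (i + 1) - a i) ≤
      ∑ j ∈ Finset.range n, b j * (forwardAverage w a (j + 1) - forwardAverage w a j) := by
  have hd : ∀ i, 0 ≤ a (i + 1) - a i := fun i => sub_nonneg.2 (ha (Nat.le_succ i))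
  -- For one offset `k`, the terms with `i < k` vanish and `i = j + k` reindexes the rest over `j <
  -- n - k`; extending to `j < n` adds nonnegative terms.
  have h1 : ∀ k, ∑ i ∈ Finset.range n, pastValue b i k * (a (i + 1) - a i) ≤
      ∑ j ∈ Finset.range n, b j * (a (j + k + 1) - a (j + k)) := by
    intro k
    have : ∑ j ∈ Finset.range (n - k), b j * (a (j + k + 1) - a (j + k)) ≤
        ∑ j ∈ Finset.range n, b j * (a (j + k + 1) - a (j + k)) :=
      Finset.sum_le_sum_of_subset_of_nonneg (Finset.range_mono (Nat.sub_le n k))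
        fun j _ _ => mul_nonneg (hb0 j) (hd _)
    refine le_trans (le_of_eq ?_) this
    rcases le_total k n with hk | hk
    · obtain ⟨m, rfl⟩ := Nat.exists_eq_add_of_le hk
      rw [Finset.sum_range_add, Finset.sum_eq_zero, zero_add]
      · simp only [Nat.add_sub_cancel_left]
        refine Finset.sum_congr rfl fun j _ => ?_
        simp [pastValue, add_comm k j]
      · intro i hi
        have := Finset.mem_range.1 hi
        simp [pastValue, not_le.2 this]
    · rw [Nat.sub_eq_zero_of_le hk, Finset.range_zero, Finset.sum_empty]
      refine Finset.sum_eq_zero fun i hi => ?_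
      have : i < k := (Finset.mem_range.1 hi).trans_le hk
      simp [pastValue, not_le.2 this]
  calc ∑ i ∈ Finset.range n, backwardAverage w b i * (a (i + 1) - a i)
      = (∑ k ∈ Finset.range w, ∑ i ∈ Finset.range n,
          pastValue b i k * (a (i + 1) - a i)) / w := by
        rw [Finset.sum_comm, Finset.sum_div]
        refine Finset.sum_congr rfl fun i _ => ?_
        rw [← Finset.sum_mul, backwardAverage]
        ring
    _ ≤ (∑ k ∈ Finset.range w, ∑ j ∈ Finset.range n, b j * (a (j + k + 1) - a (j + k))) / w := by
        exact div_le_div_of_nonneg_right (Finset.sum_le_sum fun k _ => h1 k) (Nat.cast_nonneg w)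
    _ = _ := by
        rw [Finset.sum_comm, Finset.sum_div]
        refine Finset.sum_congr rfl fun j _ => ?_
        rw [← Finset.mul_sum, Finset.sum_sub_distrib, forwardAverage, forwardAverage]
        simp only [Nat.add_right_comm j]
        ring

end Averages

theorem continuousOn_primitive_Icc {p : ℝ → ℝ} (hp : ContinuousOn p (Icc 0 1)) :
    ContinuousOn (fun t => ∫ z in (0 : ℝ)..t, p z) (Icc 0 1) := by
  have := intervalIntegral.continuousOn_primitive_interval (μ := MeasureTheory.volume)
    (a := (0 : ℝ)) (b := 1) (f := p)
    (by rw [uIcc_of_le zero_le_one]; exact hp.integrableOn_Icc)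
  rwa [uIcc_of_le zero_le_one] at this

/-! ### Riemann-Stieltjes sums of monotone functions -/

theorem sum_mul_sub_le_integral {f : ℝ → ℝ} (hf : MonotoneOn f (Icc 0 1))
    (hfr : ∀ x ∈ Icc (0 : ℝ) 1, 0 ≤ f x) {y : ℕ → ℝ} (hy : Monotone y)
    (hyr : ∀ i, y i ∈ Icc (0 : ℝ) 1) (n : ℕ) :
    ∑ j ∈ Finset.range n, f (y j) * (y (j + 1) - y j) ≤ ∫ z in (0 : ℝ)..(y n), f z := by
  have hint : ∀ u ∈ Icc (0 : ℝ) 1, ∀ v ∈ Icc (0 : ℝ) 1,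
      IntervalIntegrable f MeasureTheory.volume u v := fun u hu v hv =>
    (hf.mono (ordConnected_Icc.uIcc_subset hu hv)).intervalIntegrable
  induction n with
  | zero =>
    simp only [Finset.range_zero, Finset.sum_empty]
    exact intervalIntegral.integral_nonneg (hyr 0).1
      fun u hu => hfr u ⟨hu.1, hu.2.trans (hyr 0).2⟩
  | succ n ih =>
    rw [Finset.sum_range_succ, ← intervalIntegral.integral_add_adjacent_intervals
      (hint 0 (by simp) _ (hyr n)) (hint _ (hyr n) _ (hyr (n + 1)))]
    refine add_le_add ih ?_
    have h := intervalIntegral.integral_mono_on (hy (Nat.le_succ n)) (f := fun _ => f (y n))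
      intervalIntegrable_const (hint _ (hyr n) _ (hyr (n + 1)))
      fun z hz => hf (hyr n) ⟨(hyr n).1.trans hz.1, hz.2.trans (hyr (n + 1)).2⟩ hz.1
    rw [intervalIntegral.integral_const, smul_eq_mul] at h
    linarith

/-- The left side is the Stieltjes integral of x dg, and the sum weights each increment of `g` by
the right endpoint, so it overestimates; no differentiability of `g` is involved. -/
theorem mul_sub_integral_le_sum {g : ℝ → ℝ} (hg : MonotoneOn g (Icc 0 1))
    (hgr : ∀ x ∈ Icc (0 : ℝ) 1, 0 ≤ g x) {x : ℕ → ℝ} (hx : Monotone x)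
    (hxr : ∀ i, x i ∈ Icc (0 : ℝ) 1) (n : ℕ) :
    x n * g (x n) - ∫ z in (0 : ℝ)..(x n), g z ≤
      x 0 * g (x 0) + ∑ i ∈ Finset.range n, x (i + 1) * (g (x (i + 1)) - g (x i)) := by
  have hint : ∀ u ∈ Icc (0 : ℝ) 1, ∀ v ∈ Icc (0 : ℝ) 1,
      IntervalIntegrable g MeasureTheory.volume u v := fun u hu v hv =>
    (hg.mono (ordConnected_Icc.uIcc_subset hu hv)).intervalIntegrable
  induction n with
  | zero =>
    simp only [Finset.range_zero, Finset.sum_empty]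
    have := intervalIntegral.integral_nonneg (hxr 0).1 (μ := MeasureTheory.volume)
      fun u hu => hgr u ⟨hu.1, hu.2.trans (hxr 0).2⟩
    linarith
  | succ n ih =>
    rw [Finset.sum_range_succ, ← intervalIntegral.integral_add_adjacent_intervals
      (hint 0 (by simp) _ (hxr n)) (hint _ (hxr n) _ (hxr (n + 1)))]
    have h := intervalIntegral.integral_mono_on (hx (Nat.le_succ n)) (f := fun _ => g (x n))
      intervalIntegrable_const (hint _ (hxr n) _ (hxr (n + 1)))
      fun z hz => hg (hxr n) ⟨(hxr n).1.trans hz.1, hz.2.trans (hxr (n + 1)).2⟩ hz.1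
    rw [intervalIntegral.integral_const, smul_eq_mul] at h
    linarith

/-! ### Convergence of the half-infinite chain -/

section Chain

variable {f g : ℝ → ℝ} {w : ℕ}

theorem chainStep_mem_Icc (hw : 0 < w) (hfr : MapsTo f (Icc 0 1) (Icc 0 1))
    (hgr : MapsTo g (Icc 0 1) (Icc 0 1)) {x : ℕ → ℝ} (hx : ∀ i, x i ∈ Icc (0 : ℝ) 1) (i : ℕ) :
    chainStep f g w x i ∈ Icc (0 : ℝ) 1 := by
  have h : ∀ j, f (forwardAverage w (fun i => g (x i)) j) ∈ Icc (0 : ℝ) 1 := fun j =>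
    hfr (forwardAverage_mem_Icc hw fun k _ => hgr (hx _))
  exact ⟨backwardAverage_nonneg (fun j => (h j).1) i,
    backwardAverage_le hw zero_le_one fun j _ => (h j).2⟩

theorem chainStep_le_chainStep (hw : 0 < w) (hf : MonotoneOn f (Icc 0 1))
    (hg : MonotoneOn g (Icc 0 1)) (hgr : MapsTo g (Icc 0 1) (Icc 0 1))
    {x y : ℕ → ℝ} (hx : ∀ i, x i ∈ Icc (0 : ℝ) 1) (hy : ∀ i, y i ∈ Icc (0 : ℝ) 1)
    (h : ∀ i, x i ≤ y i) (i : ℕ) : chainStep f g w x i ≤ chainStep f g w y i :=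
  backwardAverage_le_backwardAverage (fun _ =>
    hf (forwardAverage_mem_Icc hw fun _ _ => hgr (hx _))
      (forwardAverage_mem_Icc hw fun _ _ => hgr (hy _))
      (forwardAverage_le_forwardAverage fun _ _ => hg (hx _) (hy _) (h _))) i

theorem chainStep_mono (hw : 0 < w) (hf : MonotoneOn f (Icc 0 1))
    (hfr : MapsTo f (Icc 0 1) (Icc 0 1))
    (hg : MonotoneOn g (Icc 0 1)) (hgr : MapsTo g (Icc 0 1) (Icc 0 1))
    {x : ℕ → ℝ} (hx : ∀ i, x i ∈ Icc (0 : ℝ) 1) (hm : Monotone x) :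
    Monotone (chainStep f g w x) := by
  have h : ∀ j, forwardAverage w (fun i => g (x i)) j ∈ Icc (0 : ℝ) 1 := fun j =>
    forwardAverage_mem_Icc hw fun k _ => hgr (hx _)
  refine backwardAverage_mono (fun i j hij => hf (h i) (h j) ?_) fun j => (hfr (h j)).1
  exact forwardAverage_le_forwardAverage fun k _ => hg (hx _) (hx _) (hm (by omega))

theorem chainSeq_mem_Icc (hw : 0 < w) (hfr : MapsTo f (Icc 0 1) (Icc 0 1))
    (hgr : MapsTo g (Icc 0 1) (Icc 0 1)) (l i : ℕ) : chainSeq f g w l i ∈ Icc (0 : ℝ) 1 := by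
  induction l generalizing i with
  | zero => simp [chainSeq]
  | succ l ih => exact chainStep_mem_Icc hw hfr hgr ih i

theorem chainSeq_mono (hw : 0 < w) (hf : MonotoneOn f (Icc 0 1))
    (hfr : MapsTo f (Icc 0 1) (Icc 0 1))
    (hg : MonotoneOn g (Icc 0 1)) (hgr : MapsTo g (Icc 0 1) (Icc 0 1)) (l : ℕ) :
    Monotone (chainSeq f g w l) := by
  induction l with
  | zero => exact monotone_const
  | succ l ih => exact chainStep_mono hw hf hfr hg hgr (chainSeq_mem_Icc hw hfr hgr l) ih

theorem chainSeq_antitone (hw : 0 < w) (hf : MonotoneOn f (Icc 0 1))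
    (hfr : MapsTo f (Icc 0 1) (Icc 0 1))
    (hg : MonotoneOn g (Icc 0 1)) (hgr : MapsTo g (Icc 0 1) (Icc 0 1)) (i : ℕ) :
    Antitone fun l => chainSeq f g w l i := by
  refine antitone_nat_of_succ_le fun l => ?_
  induction l generalizing i with
  | zero => exact (chainSeq_mem_Icc hw hfr hgr 1 i).2
  | succ l ih =>
    exact chainStep_le_chainStep hw hf hg hgr (chainSeq_mem_Icc hw hfr hgr _)
      (chainSeq_mem_Icc hw hfr hgr _) ih i

theorem tendsto_forwardAverage {ι : Type*} {u : Filter ι} {a : ι → ℕ → ℝ} {b : ℕ → ℝ}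
    (h : ∀ i, Tendsto (fun l => a l i) u (𝓝 (b i))) (j : ℕ) :
    Tendsto (fun l => forwardAverage w (a l) j) u (𝓝 (forwardAverage w b j)) :=
  (tendsto_finsetSum _ fun _ _ => h _).div_const _

theorem tendsto_backwardAverage {ι : Type*} {u : Filter ι} {a : ι → ℕ → ℝ} {b : ℕ → ℝ}
    (h : ∀ i, Tendsto (fun l => a l i) u (𝓝 (b i))) (j : ℕ) :
    Tendsto (fun l => backwardAverage w (a l) j) u (𝓝 (backwardAverage w b j)) := by
  refine (tendsto_finsetSum _ fun k _ => ?_).div_const _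
  unfold pastValue
  split_ifs
  exacts [h _, tendsto_const_nhds]

theorem tendsto_comp_of_continuousOn_Icc {ι : Type*} {u : Filter ι} {p : ℝ → ℝ}
    (hp : ContinuousOn p (Icc 0 1)) {a : ι → ℝ} {b : ℝ} (ha : ∀ l, a l ∈ Icc (0 : ℝ) 1)
    (hb : b ∈ Icc (0 : ℝ) 1) (h : Tendsto a u (𝓝 b)) :
    Tendsto (fun l => p (a l)) u (𝓝 (p b)) :=
  (hp b hb).tendsto.comp (tendsto_nhdsWithin_iff.2 ⟨h, Eventually.of_forall ha⟩)

/-- The half-infinite chain converges to a nondecreasing fixed point. -/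
theorem exists_tendsto_chainSeq (hw : 0 < w) (hf : MonotoneOn f (Icc 0 1))
    (hfr : MapsTo f (Icc 0 1) (Icc 0 1)) (hfc : ContinuousOn f (Icc 0 1))
    (hg : MonotoneOn g (Icc 0 1)) (hgr : MapsTo g (Icc 0 1) (Icc 0 1))
    (hgc : ContinuousOn g (Icc 0 1)) :
    ∃ x : ℕ → ℝ, (∀ i, Tendsto (fun l => chainSeq f g w l i) atTop (𝓝 (x i))) ∧
      (∀ i, x i ∈ Icc (0 : ℝ) 1) ∧ Monotone x ∧ chainStep f g w x = x := by
  have hmem := chainSeq_mem_Icc hw hfr hgr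
  have hlim : ∀ i, ∃ y, Tendsto (fun l => chainSeq f g w l i) atTop (𝓝 y) := fun i =>
    ⟨_, tendsto_atTop_ciInf (chainSeq_antitone hw hf hfr hg hgr i)
      ⟨0, by rintro _ ⟨l, rfl⟩; exact (hmem l i).1⟩⟩
  choose x hx using hlim
  have hxr : ∀ i, x i ∈ Icc (0 : ℝ) 1 := fun i =>
    isClosed_Icc.mem_of_tendsto (hx i) (Eventually.of_forall fun l => hmem l i)
  refine ⟨x, hx, hxr, fun i j hij => le_of_tendsto_of_tendsto' (hx i) (hx j)
    fun l => chainSeq_mono hw hf hfr hg hgr l hij, funext fun i => ?_⟩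
  refine tendsto_nhds_unique ?_ ((tendsto_add_atTop_iff_nat 1).2 (hx i))
  refine tendsto_backwardAverage (fun j => ?_) i
  refine tendsto_comp_of_continuousOn_Icc hfc
    (fun l => forwardAverage_mem_Icc hw fun _ _ => hgr (hmem _ _))
    (forwardAverage_mem_Icc hw fun _ _ => hgr (hxr _)) (tendsto_forwardAverage (fun k => ?_) j)
  exact tendsto_comp_of_continuousOn_Icc hgc (fun l => hmem l k) (hxr k) (hx k)

/-- The key estimate: the uncoupled potential at the limit of a fixed point of the half-infinite
chain is at most `1 / w`. -/
theorem potential_le_of_chainStep_eq (hw : 0 < w) (hf : MonotoneOn f (Icc 0 1))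
    (hfr : MapsTo f (Icc 0 1) (Icc 0 1)) (hfc : ContinuousOn f (Icc 0 1))
    (hg : MonotoneOn g (Icc 0 1)) (hgr : MapsTo g (Icc 0 1) (Icc 0 1))
    (hgc : ContinuousOn g (Icc 0 1)) {x : ℕ → ℝ} (hxr : ∀ i, x i ∈ Icc (0 : ℝ) 1)
    (hx : Monotone x) (hfix : chainStep f g w x = x) :
    ∃ s ∈ Icc (0 : ℝ) 1, (∀ i, x i ≤ s) ∧ s ≤ f (g s) ∧
      s * g s - (∫ z in (0 : ℝ)..s, g z) - (∫ z in (0 : ℝ)..(g s), f z) ≤ 1 / w := by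
  have hw' : (0 : ℝ) < w := by exact_mod_cast hw
  have hs := tendsto_atTop_ciSup hx ⟨1, by rintro _ ⟨l, rfl⟩; exact (hxr l).2⟩
  set s := ⨆ i, x i
  have hsr : s ∈ Icc (0 : ℝ) 1 := isClosed_Icc.mem_of_tendsto hs (Eventually.of_forall hxr)
  have hxs : ∀ i, x i ≤ s := hx.ge_of_tendsto hs
  set a : ℕ → ℝ := fun i => g (x i) with ha
  set y : ℕ → ℝ := forwardAverage w a with hy
  have har : ∀ i, a i ∈ Icc (0 : ℝ) 1 := fun i => hgr (hxr i)
  have ham : Monotone a := fun i j hij => hg (hxr i) (hxr j) (hx hij)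
  have hyr : ∀ i, y i ∈ Icc (0 : ℝ) 1 := fun i => forwardAverage_mem_Icc hw fun _ _ => har _
  have hym : Monotone y := fun i j hij =>
    forwardAverage_le_forwardAverage fun k _ => ham (by omega)
  have hb0 : ∀ j, 0 ≤ f (y j) := fun j => (hfr (hyr j)).1
  have hxb : ∀ i, x i = backwardAverage w (fun j => f (y j)) i := fun i => (congrFun hfix i).symm
  have hga : Tendsto a atTop (𝓝 (g s)) := tendsto_comp_of_continuousOn_Icc hgc hxr hsr hs
  -- `y n` is the average at position 0 of the sequence shifted by `n`, whose entries all tend to `g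
  -- s`.
  have hgy : Tendsto y atTop (𝓝 (g s)) := by
    have h := tendsto_forwardAverage (w := w) (u := atTop) (a := fun n k => a (n + k))
      (b := fun _ => g s) (fun k => (tendsto_add_atTop_iff_nat k).2 hga) 0
    have h2 : forwardAverage w (fun _ => g s) 0 = g s := by
      simp [forwardAverage, hw'.ne']
    rw [h2] at h
    refine h.congr fun n => ?_
    simp [forwardAverage, hy]
  refine ⟨s, hsr, hxs, ?_, ?_⟩
  · refine le_of_tendsto' hs fun i => ?_
    rw [hxb i]
    refine backwardAverage_le hw (hfr (hgr hsr)).1 fun j _ => hf (hyr j) (hgr hsr) ?_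
    exact (forwardAverage_mem_Icc hw (c := 0)
      fun k _ => ⟨(har _).1, hg (hxr _) hsr (hxs _)⟩).2
  -- Adjointness compares Σ x_i Δa_i with Σ f(y_j) Δy_j ≤ F(y_n), whereas x g - G is bounded by a
  -- sum with x_{i+1} in place of x_i. As x_0 and all increments of x are at most 1/w, the total
  -- error is at most (1/w) a_n ≤ 1/w.
  · have hbound : ∀ n, x n * g (x n) - (∫ z in (0 : ℝ)..(x n), g z) -
        (∫ z in (0 : ℝ)..(y n), f z) ≤ 1 / w := by
      intro n
      have h1 := mul_sub_integral_le_sum hg (fun z hz => (hgr hz).1) hx hxr n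
      have h2 := sum_mul_sub_le_integral hf (fun z hz => (hfr hz).1) hym hyr n
      have h3 := sum_backwardAverage_mul_sub_le (w := w) ham hb0 n
      simp only [← hxb] at h3
      have hx0 : x 0 ≤ 1 / w := by
        rw [hxb]
        refine (backwardAverage_zero_le hb0).trans ?_
        gcongr
        exact (hfr (hyr 0)).2
      have hstep : ∀ i, x (i + 1) - x i ≤ 1 / w := by
        intro i
        have := backwardAverage_succ_le (w := w) hb0 i
        rw [← hxb, ← hxb] at this
        have h4 : f (y (i + 1)) / w ≤ 1 / w := by
          gcongr
          exact (hfr (hyr _)).2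
        linarith
      have h5 : ∑ i ∈ Finset.range n, x (i + 1) * (a (i + 1) - a i) ≤
          ∑ i ∈ Finset.range n, x i * (a (i + 1) - a i) +
          ∑ i ∈ Finset.range n, 1 / w * (a (i + 1) - a i) := by
        rw [← Finset.sum_add_distrib]
        refine Finset.sum_le_sum fun i _ => ?_
        rw [← add_mul]
        exact mul_le_mul_of_nonneg_right (by linarith [hstep i])
          (sub_nonneg.2 (ham (Nat.le_succ i)))
      rw [← Finset.mul_sum, Finset.sum_range_sub] at h5
      have h6 : x 0 * a 0 ≤ 1 / w * a 0 := mul_le_mul_of_nonneg_right hx0 (har 0).1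
      have h7 : 1 / (w : ℝ) * a n ≤ 1 / w := mul_le_of_le_one_right (by positivity) (har n).2
      simp only [ha, hy] at *
      linarith
    have hlim : Tendsto (fun n => x n * g (x n) - (∫ z in (0 : ℝ)..(x n), g z) -
        (∫ z in (0 : ℝ)..(y n), f z)) atTop (𝓝 (s * g s - (∫ z in (0 : ℝ)..s, g z) -
        (∫ z in (0 : ℝ)..(g s), f z))) :=
      ((hs.mul hga).sub (tendsto_comp_of_continuousOn_Icc (continuousOn_primitive_Icc hgc) hxr hsr hs)).sub
        (tendsto_comp_of_continuousOn_Icc (continuousOn_primitive_Icc hfc) hyr (hgr hsr) hgy)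
    exact le_of_tendsto' hlim hbound

end Chain

/-! ### Threshold saturation -/

section Saturation

variable {f g : ℝ → ℝ → ℝ} {ε : ℝ}

theorem sum_couplingMatrix_mul_le_forwardAverage {N w : ℕ} {a : Fin (N + w - 1) → ℝ} {b : ℕ → ℝ}
    (hb : ∀ k, 0 ≤ b k) (hab : ∀ k, a k ≤ b k) (j : Fin N) :
    ∑ k, couplingMatrix N w j k * a k ≤ forwardAverage w b j := by
  calc ∑ k, couplingMatrix N w j k * a k
      ≤ ∑ k : Fin (N + w - 1),
          if (j : ℕ) ≤ (k : ℕ) ∧ (k : ℕ) < j + w then 1 / (w : ℝ) * b k else 0 := by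
        refine Finset.sum_le_sum fun k _ => ?_
        unfold couplingMatrix
        split_ifs
        · exact mul_le_mul_of_nonneg_left (hab k) (by positivity)
        · simp
    _ = ∑ k ∈ (Finset.range (N + w - 1)).filter fun k => (j : ℕ) ≤ k ∧ k < j + w,
          1 / (w : ℝ) * b k := by
        rw [Fin.sum_univ_eq_sum_range
          (fun k => if (j : ℕ) ≤ k ∧ k < j + w then 1 / (w : ℝ) * b k else 0), Finset.sum_filter]
    _ ≤ ∑ k ∈ Finset.Ico (j : ℕ) (j + w), 1 / (w : ℝ) * b k :=
        Finset.sum_le_sum_of_subset_of_nonneg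
          (fun k hk => Finset.mem_Ico.2 (Finset.mem_filter.1 hk).2)
          fun k _ _ => mul_nonneg (by positivity) (hb k)
    _ = forwardAverage w b j := by
        rw [Finset.sum_Ico_eq_sum_range, ← Finset.mul_sum, forwardAverage]
        simp only [Nat.add_sub_cancel_left]
        ring

/-- Column `i` is supported on the positions of the backward window that are below `N`. Positions
before 0 contribute nothing on either side, while those from `N` on occur only in the half-infinite
chain, whence an inequality. -/
theorem sum_couplingMatrix_mul_le_backwardAverage {N w : ℕ} {a : Fin N → ℝ} {b : ℕ → ℝ}
    (hb : ∀ k, 0 ≤ b k) (hab : ∀ k, a k ≤ b k) (i : Fin (N + w - 1)) :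
    ∑ j, couplingMatrix N w j i * a j ≤ backwardAverage w b i := by
  set s := (Finset.range N).filter fun j => j ≤ (i : ℕ) ∧ (i : ℕ) < j + w with hs
  calc ∑ j, couplingMatrix N w j i * a j
      ≤ ∑ j : Fin N,
          if (j : ℕ) ≤ (i : ℕ) ∧ (i : ℕ) < j + w then b j / w else 0 := by
        refine Finset.sum_le_sum fun j _ => ?_
        unfold couplingMatrix
        split_ifs
        · rw [one_div_mul_eq_div]
          exact div_le_div_of_nonneg_right (hab j) (by positivity)
        · simp
    _ = ∑ j ∈ s, b j / w := by
        rw [Fin.sum_univ_eq_sum_range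
          (fun j => if j ≤ (i : ℕ) ∧ (i : ℕ) < j + w then b j / (w : ℝ) else 0),
          hs, Finset.sum_filter]
    _ = (∑ j ∈ s, pastValue b i (i - j)) / w := by
        rw [Finset.sum_div]
        refine Finset.sum_congr rfl fun j hj => ?_
        have hj := (Finset.mem_filter.1 hj).2.1
        rw [pastValue, if_pos (Nat.sub_le _ _), Nat.sub_sub_self hj]
    _ = (∑ k ∈ s.image (fun j => (i : ℕ) - j), pastValue b i k) / w := by
        rw [Finset.sum_image]
        intro j hj k hk hjk
        have h1 := (Finset.mem_filter.1 hj).2.1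
        have h2 := (Finset.mem_filter.1 hk).2.1
        simp only at hjk
        omega
    _ ≤ backwardAverage w b i := by
        refine div_le_div_of_nonneg_right (Finset.sum_le_sum_of_subset_of_nonneg (fun k hk => ?_)
          fun k _ _ => pastValue_nonneg hb i k) (Nat.cast_nonneg w)
        obtain ⟨j, hj, rfl⟩ := Finset.mem_image.1 hk
        have := (Finset.mem_filter.1 hj).2
        exact Finset.mem_range.2 (by omega)

/-- The coupled recursion on a finite chain is dominated by the one on the half-infinite chain. -/
theorem coupledSeq_le_chainSeq (hf : MonotoneOn (fun z => f z ε) (Icc 0 1))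
    (hfr : MapsTo (fun z => f z ε) (Icc 0 1) (Icc 0 1))
    (hg : MonotoneOn (fun z => g z ε) (Icc 0 1))
    (hgr : MapsTo (fun z => g z ε) (Icc 0 1) (Icc 0 1)) {N w : ℕ} (hw : 0 < w)
    (l : ℕ) (i : Fin (N + w - 1)) : 0 ≤ coupledSeq f g ε N w l i ∧
      coupledSeq f g ε N w l i ≤ chainSeq (fun z => f z ε) (fun z => g z ε) w l i := by
  have hA : ∀ j k, 0 ≤ couplingMatrix N w j k := fun j k => by
    unfold couplingMatrix
    split_ifs <;> positivity
  induction l generalizing i with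
  | zero => simp [coupledSeq, chainSeq]
  | succ l ih =>
    have hmem := chainSeq_mem_Icc (w := w) hw hfr hgr l
    have hxr : ∀ i, coupledSeq f g ε N w l i ∈ Icc (0 : ℝ) 1 := fun i =>
      ⟨(ih i).1, (ih i).2.trans (hmem i).2⟩
    have hY : ∀ j, forwardAverage w
        (fun k => g (chainSeq (fun z => f z ε) (fun z => g z ε) w l k) ε) j ∈ Icc (0 : ℝ) 1 :=
      fun j => forwardAverage_mem_Icc hw fun k _ => hgr (hmem _)
    have hle : ∀ j : Fin N,
        ∑ k, couplingMatrix N w j k * g (coupledSeq f g ε N w l k) ε ≤ forwardAverage w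
          (fun k => g (chainSeq (fun z => f z ε) (fun z => g z ε) w l k) ε) j :=
      sum_couplingMatrix_mul_le_forwardAverage (fun k => (hgr (hmem k)).1)
        fun k => hg (hxr k) (hmem k) (ih k).2
    have hy : ∀ j : Fin N,
        ∑ k, couplingMatrix N w j k * g (coupledSeq f g ε N w l k) ε ∈ Icc (0 : ℝ) 1 := fun j =>
      ⟨Finset.sum_nonneg fun k _ => mul_nonneg (hA j k) (hgr (hxr k)).1,
        (hle j).trans (hY j).2⟩
    exact ⟨Finset.sum_nonneg fun j _ => mul_nonneg (hA j i) (hfr (hy j)).1,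
      sum_couplingMatrix_mul_le_backwardAverage (fun j => (hfr (hY j)).1)
        (fun j => hf (hy j) (hY j) (hle j)) i⟩

theorem continuousOn_potential (hfc : ContinuousOn (fun z => f z ε) (Icc 0 1))
    (hgc : ContinuousOn (fun z => g z ε) (Icc 0 1))
    (hgr : MapsTo (fun z => g z ε) (Icc 0 1) (Icc 0 1)) :
    ContinuousOn (fun x => potential f g x ε) (Icc 0 1) :=
  ((continuousOn_id.mul hgc).sub (continuousOn_primitive_Icc hgc)).sub
    ((continuousOn_primitive_Icc hfc).comp hgc hgr)

/-- Threshold saturation: if `0` is stable and the unique minimizer of the potential, then the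
coupled recursion converges to zero once the coupling width is large, uniformly in the chain
length. -/
theorem exists_forall_tendsto_coupledSeq (hf : MonotoneOn (fun z => f z ε) (Icc 0 1))
    (hfr : MapsTo (fun z => f z ε) (Icc 0 1) (Icc 0 1))
    (hfc : ContinuousOn (fun z => f z ε) (Icc 0 1))
    (hg : MonotoneOn (fun z => g z ε) (Icc 0 1))
    (hgr : MapsTo (fun z => g z ε) (Icc 0 1) (Icc 0 1))
    (hgc : ContinuousOn (fun z => g z ε) (Icc 0 1))
    (hstab : StableAtZero f g ε) (hpos : ∀ x ∈ Ioc (0 : ℝ) 1, 0 < potential f g x ε) :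
    ∃ w₀ : ℕ, ∀ w > w₀, ∀ N ≥ 1, ∀ i : Fin (N + w - 1),
      Tendsto (fun l : ℕ => coupledSeq f g ε N w l i) atTop (𝓝 0) := by
  obtain ⟨δ, hδ, hst⟩ := hstab
  -- The minimum over [δ,1] is positive by compactness. It alone determines `w₀`, which is therefore
  -- independent of `N`.
  obtain ⟨m, hm, hmin⟩ := isCompact_Icc.exists_isMinOn (nonempty_Icc.2 hδ.2)
    ((continuousOn_potential hfc hgc hgr).mono (Icc_subset_Icc_left hδ.1.le))
  have hmpos := hpos m ⟨hδ.1.trans_le hm.1, hm.2⟩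
  obtain ⟨w₀, hw₀⟩ := exists_nat_gt (1 / potential f g m ε)
  refine ⟨w₀, fun w hw N _ i => ?_⟩
  have hw0 : 0 < w := (Nat.zero_le _).trans_lt hw
  obtain ⟨x, hlim, hxr, hx, hfix⟩ := exists_tendsto_chainSeq hw0 hf hfr hfc hg hgr hgc
  obtain ⟨s, hs, hxs, hsh, hU⟩ :=
    potential_le_of_chainStep_eq hw0 hf hfr hfc hg hgr hgc hxr hx hfix
  -- A positive `s ≤ δ` contradicts stability because s ≤ h(s); an `s > δ` contradicts U(s) ≤ 1/w.
  have hs0 : s = 0 := by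
    by_contra hne
    have hspos : 0 < s := lt_of_le_of_ne hs.1 (Ne.symm hne)
    have hδs : δ < s := by
      by_contra! hle
      exact (hst s ⟨hspos, hle⟩).not_ge hsh
    have h1 : potential f g m ε ≤ potential f g s ε := hmin ⟨hδs.le, hs.2⟩
    have h2 : 1 / (w : ℝ) < potential f g m ε := by
      have : (w₀ : ℝ) < w := by exact_mod_cast hw
      exact (one_div_lt (by exact_mod_cast hw0) hmpos).2 (hw₀.trans this)
    exact (h1.trans hU).not_gt h2
  have hx0 : x i = 0 := le_antisymm (hs0 ▸ hxs i) (hxr i).1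
  exact squeeze_zero (fun l => (coupledSeq_le_chainSeq hf hfr hg hgr hw0 l i).1)
    (fun l => (coupledSeq_le_chainSeq hf hfr hg hgr hw0 l i).2) (hx0 ▸ hlim i)

end Saturation
end SpatialCoupling

namespace SpatialCoupling

/-! ### Polynomials -/

theorem eval_monotoneOn_of_coeff_nonneg {p : Polynomial ℝ} (hp : ∀ i, 0 ≤ p.coeff i) :
    MonotoneOn (fun x => p.eval x) (Ici 0) := by
  intro x hx y _ hxy
  simp only [Polynomial.eval_eq_sum_range]
  have hx : (0 : ℝ) ≤ x := hx
  gcongr with i _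
  exact hp i

theorem eval_pos_of_coeff_nonneg {p : Polynomial ℝ} (hp : ∀ i, 0 ≤ p.coeff i) (h0 : p ≠ 0)
    {x : ℝ} (hx : 0 < x) : 0 < p.eval x := by
  rw [Polynomial.eval_eq_sum_range]
  refine Finset.sum_pos' (fun i _ => mul_nonneg (hp i) (pow_nonneg hx.le i))
    ⟨p.natDegree, by simp, mul_pos (lt_of_le_of_ne (hp _) ?_) (pow_pos hx _)⟩
  exact (Polynomial.leadingCoeff_ne_zero.2 h0).symm

theorem coeff_derivative_nonneg {p : Polynomial ℝ} (hp : ∀ i, 0 ≤ p.coeff i) (i : ℕ) :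
    0 ≤ p.derivative.coeff i := by
  rw [Polynomial.coeff_derivative]
  exact mul_nonneg (hp _) (by positivity)

/-- A polynomial has a constant sign to the right of zero. -/
theorem eventually_eval_pos_of_frequently {p : Polynomial ℝ}
    (h : ∃ᶠ x in 𝓝[>] (0 : ℝ), 0 < p.eval x) : ∀ᶠ x in 𝓝[>] (0 : ℝ), 0 < p.eval x := by
  have hp : p ≠ 0 := by
    rintro rfl
    simp at h
  have hroots : ∀ᶠ x in 𝓝[>] (0 : ℝ), p.eval x ≠ 0 := by
    have h1 : ∀ᶠ x in 𝓝 (0 : ℝ), x ∉ (p.roots.toFinset.erase 0 : Set ℝ) :=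
      (Finset.finite_toSet _).isClosed.isOpen_compl.mem_nhds (by simp)
    filter_upwards [h1.filter_mono nhdsWithin_le_nhds, self_mem_nhdsWithin] with x hx hx0 h0
    exact hx (by simp [hp, h0, (mem_Ioi.1 hx0).ne'])
  -- There is no root in (0,δ), so a single positive value there fixes the sign by the intermediate
  -- value theorem.
  obtain ⟨δ, hδ, hsub⟩ := mem_nhdsGT_iff_exists_Ioo_subset.1 hroots
  obtain ⟨y, hy, hyδ⟩ := (h.and_eventually (Ioo_mem_nhdsGT hδ)).exists
  filter_upwards [Ioo_mem_nhdsGT hδ] with x hx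
  by_contra! hneg
  obtain ⟨z, hz, hz0⟩ := isPreconnected_Ioo.intermediate_value hx hyδ
    p.continuous.continuousOn ⟨hneg, hy.le⟩
  exact hsub hz hz0

/-! ### The uncoupled potential -/

section Potential

variable {f g : ℝ → ℝ → ℝ} {ε : ℝ}

/-- In g + x g' - g - f(g) g' the two g cancel. Where g' > 0, U thus rises or falls according to the
sign of x - h(x), which ties minimizers to fixed points. -/
theorem hasDerivAt_potential (hfc : ContinuousOn (fun z => f z ε) (Icc 0 1))
    (hgc : ContinuousOn (fun z => g z ε) (Icc 0 1)) {x g' : ℝ} (hx : x ∈ Ioo (0 : ℝ) 1)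
    (hgx : g x ε ∈ Ioo (0 : ℝ) 1) (hg : HasDerivAt (fun z => g z ε) g' x) :
    HasDerivAt (fun x => potential f g x ε) ((x - update f g x ε) * g') x := by
  have key : ∀ p : ℝ → ℝ, ContinuousOn p (Icc 0 1) → ∀ y ∈ Ioo (0 : ℝ) 1,
      HasDerivAt (fun t => ∫ z in (0 : ℝ)..t, p z) (p y) y := fun p hp y hy =>
    intervalIntegral.integral_hasDerivAt_right
      ((hp.mono (by rw [uIcc_of_le hy.1.le]; exact Icc_subset_Icc_right hy.2.le)).intervalIntegrable)
      (hp.stronglyMeasurableAtFilter_nhdsWithin measurableSet_Icc y |>.filter_mono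
        (by rw [nhdsWithin_eq_nhds.2 (Icc_mem_nhds hy.1 hy.2)]))
      (hp.continuousAt (Icc_mem_nhds hy.1 hy.2))
  have h := (((hasDerivAt_id x).mul hg).sub (key _ hgc x hx)).sub
    ((key _ hfc _ hgx).comp x hg)
  refine h.congr_deriv ?_
  simp only [update, id]
  ring

theorem potential_zero (hg : g 0 ε = 0) : potential f g 0 ε = 0 := by
  simp [potential, hg]

/-- Continuity ensures that a minimizer exists; without one the supremum would be that of the empty
set, which is 0 by default, and the left side would say nothing. -/
theorem maxMinimizer_eq_zero_iff (hc : ContinuousOn (fun x => potential f g x ε) (Icc 0 1))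
    (hg : g 0 ε = 0) :
    maxMinimizer f g ε = 0 ↔ ∀ x ∈ Ioc (0 : ℝ) 1, 0 < potential f g x ε := by
  have h0 := potential_zero (f := f) hg
  constructor
  · intro h x hx
    have hbdd : BddAbove (minimizers f g ε) := ⟨1, fun y hy => hy.1.2⟩
    have hzero : ∀ y ∈ minimizers f g ε, y = 0 := fun y hy =>
      le_antisymm (h ▸ le_csSup hbdd hy) hy.1.1
    obtain ⟨m, hm, hmin⟩ := isCompact_Icc.exists_isMinOn
      (nonempty_Icc.2 (zero_le_one (α := ℝ))) hc
    have hmm : m ∈ minimizers f g ε := ⟨hm, fun z hz => hmin hz⟩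
    rw [hzero m hmm] at hmm
    by_contra! hle
    have := hzero x ⟨⟨hx.1.le, hx.2⟩, fun z hz => (hle.trans h0.ge).trans (hmm.2 z hz)⟩
    exact hx.1.ne' this
  · intro h
    have : minimizers f g ε = {0} := by
      ext y
      simp only [mem_singleton_iff]
      constructor
      · intro hy
        by_contra hne
        have hy0 := lt_of_le_of_ne hy.1.1 (Ne.symm hne)
        have := hy.2 0 (by simp)
        linarith [h y ⟨hy0, hy.1.2⟩]
      · rintro rfl
        refine ⟨by simp, fun z hz => ?_⟩
        rw [h0]
        rcases hz.1.eq_or_lt with rfl | hz0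
        exacts [h0.ge, (h z ⟨hz0, hz.2⟩).le]
    rw [maxMinimizer, this, csSup_singleton]

end Potential

/-! ### Elementary properties of the degree distributions. -/

namespace LDPCEnsemble

variable (C : LDPCEnsemble)

/-- The coefficients of zL' - 2L are (n - 2)L_n, nonnegative because L_0 = L_1 = 0; compare the
values at 0 and 1. -/
theorem two_le_avgL : 2 ≤ C.avgL := by
  have hp : ∀ i, 0 ≤ (Polynomial.X * C.L.derivative - Polynomial.C 2 * C.L).coeff i := by
    intro i
    rw [Polynomial.coeff_sub, Polynomial.coeff_C_mul]
    match i with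
    | 0 => simp [C.L_zero]
    | 1 => simp [C.L_one, Polynomial.coeff_X_mul, Polynomial.coeff_derivative]
    | n + 2 =>
      rw [Polynomial.coeff_X_mul, Polynomial.coeff_derivative]
      have := C.L_nonneg (n + 1 + 1)
      push_cast
      nlinarith [mul_nonneg this (Nat.cast_nonneg (α := ℝ) n)]
  have h := eval_monotoneOn_of_coeff_nonneg hp (mem_Ici.2 le_rfl) (mem_Ici.2 zero_le_one)
    zero_le_one
  have h0 : C.L.eval 0 = 0 := by rw [← Polynomial.coeff_zero_eq_eval_zero, C.L_zero]
  simp [C.L_sum, h0] at h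
  exact h

theorem avgL_pos : 0 < C.avgL := zero_lt_two.trans_le C.two_le_avgL

theorem L_eval_zero : C.L.eval 0 = 0 := by
  rw [← Polynomial.coeff_zero_eq_eval_zero, C.L_zero]

theorem L_eval_mem_Icc {x : ℝ} (hx : x ∈ Icc (0 : ℝ) 1) : C.L.eval x ∈ Icc (0 : ℝ) 1 := by
  have hm := eval_monotoneOn_of_coeff_nonneg C.L_nonneg
  constructor
  · rw [← C.L_eval_zero]
    exact hm (mem_Ici.2 le_rfl) hx.1 hx.1
  · rw [← C.L_sum]
    exact hm hx.1 (mem_Ici.2 zero_le_one) hx.2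

theorem L_ne_zero : C.L ≠ 0 := fun h => by
  simpa [h] using C.L_sum

theorem L_derivative_ne_zero : C.L.derivative ≠ 0 := fun h => by
  have := C.avgL_pos
  simp [avgL, h] at this

theorem L_eval_pos {x : ℝ} (hx : 0 < x) : 0 < C.L.eval x :=
  eval_pos_of_coeff_nonneg C.L_nonneg C.L_ne_zero hx

theorem edgeL_pos {x : ℝ} (hx : 0 < x) : 0 < C.edgeL x :=
  div_pos (eval_pos_of_coeff_nonneg (coeff_derivative_nonneg C.L_nonneg)
    C.L_derivative_ne_zero hx) C.avgL_pos

theorem edgeL_zero : C.edgeL 0 = 0 := by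
  rw [edgeL, ← Polynomial.coeff_zero_eq_eval_zero, Polynomial.coeff_derivative]
  simp [C.L_one]

theorem edgeL_mem_Icc {x : ℝ} (hx : x ∈ Icc (0 : ℝ) 1) : C.edgeL x ∈ Icc (0 : ℝ) 1 := by
  constructor
  · rcases hx.1.eq_or_lt with rfl | h
    exacts [C.edgeL_zero.ge, (C.edgeL_pos h).le]
  · rw [edgeL, div_le_one C.avgL_pos]
    exact eval_monotoneOn_of_coeff_nonneg (coeff_derivative_nonneg C.L_nonneg) hx.1
      (mem_Ici.2 zero_le_one) hx.2

theorem continuous_edgeL : Continuous C.edgeL :=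
  C.L.derivative.continuous.div_const _

theorem edgeR_one (h : 0 < C.avgR) : C.edgeR 1 = 1 := div_self h.ne'

variable {C}

/-- If R'' = 0, then R(0) = 0 and R(1) = 1 force R = z, so the rate is 1 - L'(1) ≤ -1. This is how
positive rate yields g' > 0 on [0,1). -/
theorem R_derivative_derivative_ne_zero (hr : 0 < C.rate) : C.R.derivative.derivative ≠ 0 := by
  intro h
  obtain ⟨c, hc⟩ := Polynomial.natDegree_eq_zero.1
    (Polynomial.derivative_eq_zero.1 h)
  have h2 : (C.R - Polynomial.C c * Polynomial.X).derivative = 0 := by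
    rw [Polynomial.derivative_sub, Polynomial.derivative_C_mul, Polynomial.derivative_X, mul_one,
      hc, sub_self]
  obtain ⟨d, hd⟩ := Polynomial.natDegree_eq_zero.1
    (Polynomial.derivative_eq_zero.1 h2)
  have hd0 : d = 0 := by
    have := congrArg (fun p => Polynomial.coeff p 0) hd
    simpa [C.R_zero] using this
  have hR1 := congrArg (Polynomial.eval 1) hd
  simp [hd0, C.R_sum] at hR1
  have h3 : C.avgR = 1 := by
    rw [avgR, ← hc, Polynomial.eval_C]
    linarith
  have := C.two_le_avgL
  rw [rate, h3] at hr
  linarith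

theorem avgR_pos (hr : 0 < C.rate) : 0 < C.avgR :=
  eval_pos_of_coeff_nonneg (coeff_derivative_nonneg C.R_nonneg)
    (fun h => R_derivative_derivative_ne_zero hr (by simp [h])) zero_lt_one

theorem hasDerivAt_deG (x ε : ℝ) :
    HasDerivAt (fun z => C.deG z ε) (C.R.derivative.derivative.eval (1 - x) / C.avgR) x := by
  have h1 : HasDerivAt (fun z : ℝ => 1 - z) (-1) x := by
    simpa using (hasDerivAt_id x).const_sub 1
  have h2 := (((C.R.derivative.hasDerivAt (1 - x)).comp x h1).div_const C.avgR).const_sub 1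
  refine h2.congr_deriv ?_
  ring

theorem derivative_deG_pos (hr : 0 < C.rate) {x : ℝ} (hx : x < 1) :
    0 < C.R.derivative.derivative.eval (1 - x) / C.avgR :=
  div_pos (eval_pos_of_coeff_nonneg (coeff_derivative_nonneg (coeff_derivative_nonneg C.R_nonneg))
    (R_derivative_derivative_ne_zero hr) (sub_pos.2 hx)) (avgR_pos hr)

theorem continuous_deG (ε : ℝ) : Continuous fun x => C.deG x ε :=
  continuous_iff_continuousAt.2 fun x => (hasDerivAt_deG x ε).continuousAt

theorem strictMonoOn_deG (hr : 0 < C.rate) (ε : ℝ) :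
    StrictMonoOn (fun x => C.deG x ε) (Icc 0 1) := by
  refine strictMonoOn_of_deriv_pos (convex_Icc 0 1) (continuous_deG ε).continuousOn fun x hx => ?_
  rw [interior_Icc] at hx
  rw [(hasDerivAt_deG x ε).deriv]
  exact derivative_deG_pos hr hx.2

theorem deG_zero (hr : 0 < C.rate) (ε : ℝ) : C.deG 0 ε = 0 := by
  rw [deG, sub_zero, edgeR_one C (avgR_pos hr), sub_self]

theorem mapsTo_deG (hr : 0 < C.rate) (ε : ℝ) :
    MapsTo (fun x => C.deG x ε) (Icc 0 1) (Icc 0 1) := by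
  intro x hx
  constructor
  · rw [← deG_zero hr ε]
    exact (strictMonoOn_deG hr ε).monotoneOn (by simp) hx hx.1
  · refine sub_le_self 1 (div_nonneg ?_ (avgR_pos hr).le)
    have h1x : (0 : ℝ) ≤ 1 - x := sub_nonneg.2 hx.2
    refine le_trans ?_ (eval_monotoneOn_of_coeff_nonneg (coeff_derivative_nonneg C.R_nonneg)
      (mem_Ici.2 le_rfl) h1x h1x)
    simp only [← Polynomial.coeff_zero_eq_eval_zero]
    exact coeff_derivative_nonneg C.R_nonneg 0

theorem deG_mem_Ioc (hr : 0 < C.rate) (ε : ℝ) {x : ℝ} (hx : x ∈ Ioc (0 : ℝ) 1) :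
    C.deG x ε ∈ Ioc (0 : ℝ) 1 := by
  have hx' : x ∈ Icc (0 : ℝ) 1 := ⟨hx.1.le, hx.2⟩
  refine ⟨?_, (mapsTo_deG hr ε hx').2⟩
  rw [← deG_zero hr ε]
  exact strictMonoOn_deG hr ε (by simp) hx' hx.1

theorem deG_mem_Ioo (hr : 0 < C.rate) (ε : ℝ) {x : ℝ} (hx : x ∈ Ioo (0 : ℝ) 1) :
    C.deG x ε ∈ Ioo (0 : ℝ) 1 := by
  refine ⟨(deG_mem_Ioc hr ε ⟨hx.1, hx.2.le⟩).1, ?_⟩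
  exact (strictMonoOn_deG hr ε ⟨hx.1.le, hx.2.le⟩ (by simp) hx.2).trans_le
    (mapsTo_deG hr ε (right_mem_Icc.2 zero_le_one)).2

/-- The standing assumptions on an ensemble of positive rate and an extrinsic erasure rate. -/
structure Admissible (C : LDPCEnsemble) (φ : ℝ → ℝ → ℝ) : Prop where
  rate_pos : 0 < C.rate
  mem_Icc : ∀ x ∈ Icc (0 : ℝ) 1, ∀ ε ∈ Icc (0 : ℝ) 1, φ x ε ∈ Icc (0 : ℝ) 1
  continuousOn : ContinuousOn (fun p : ℝ × ℝ => φ p.1 p.2) (Icc (0 : ℝ) 1 ×ˢ Icc (0 : ℝ) 1)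
  monotoneOn : ∀ ε ∈ Icc (0 : ℝ) 1, MonotoneOn (fun x => C.deF φ x ε) (Icc 0 1)
  strictMonoOn : ∀ x ∈ Ioc (0 : ℝ) 1, StrictMonoOn (fun ε => φ x ε) (Icc 0 1)

/-! ### Density evolution: monotonicity, continuity and fixed points. -/

namespace Admissible

variable {φ : ℝ → ℝ → ℝ} (H : C.Admissible φ)
include H

theorem mapsTo_deF {ε : ℝ} (hε : ε ∈ Icc (0 : ℝ) 1) :
    MapsTo (fun x => C.deF φ x ε) (Icc 0 1) (Icc 0 1) := by
  intro x hx
  have h1 := H.mem_Icc _ (C.L_eval_mem_Icc hx) ε hε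
  have h2 := C.edgeL_mem_Icc hx
  exact ⟨mul_nonneg h1.1 h2.1, mul_le_one₀ h1.2 h2.1 h2.2⟩

theorem continuousOn_deF_prod :
    ContinuousOn (fun p : ℝ × ℝ => C.deF φ p.1 p.2) (Icc (0 : ℝ) 1 ×ˢ Icc (0 : ℝ) 1) := by
  refine ContinuousOn.mul ?_ (C.continuous_edgeL.comp continuous_fst).continuousOn
  exact H.continuousOn.comp (f := fun p : ℝ × ℝ => (C.L.eval p.1, p.2))
    (by fun_prop) fun p hp => ⟨C.L_eval_mem_Icc hp.1, hp.2⟩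

theorem continuousOn_deF {ε : ℝ} (hε : ε ∈ Icc (0 : ℝ) 1) :
    ContinuousOn (fun x => C.deF φ x ε) (Icc 0 1) :=
  H.continuousOn_deF_prod.comp (f := fun x => (x, ε)) (by fun_prop) fun _ hx => ⟨hx, hε⟩

theorem continuousOn_deF_param {x : ℝ} (hx : x ∈ Icc (0 : ℝ) 1) :
    ContinuousOn (fun ε => C.deF φ x ε) (Icc 0 1) :=
  H.continuousOn_deF_prod.comp (f := fun ε => (x, ε)) (by fun_prop) fun _ hε => ⟨hx, hε⟩

theorem strictMonoOn_deF_param {x : ℝ} (hx : x ∈ Ioc (0 : ℝ) 1) :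
    StrictMonoOn (fun ε => C.deF φ x ε) (Icc 0 1) := fun _ ha _ hb hab =>
  mul_lt_mul_of_pos_right
    (H.strictMonoOn _ ⟨C.L_eval_pos hx.1, (C.L_eval_mem_Icc ⟨hx.1.le, hx.2⟩).2⟩ ha hb hab)
    (C.edgeL_pos hx.1)

theorem monotoneOn_deF_param {x : ℝ} (hx : x ∈ Icc (0 : ℝ) 1) :
    MonotoneOn (fun ε => C.deF φ x ε) (Icc 0 1) := by
  rcases hx.1.eq_or_lt with rfl | h
  · intro a _ b _ _
    simp [deF, C.edgeL_zero]
  · exact (H.strictMonoOn_deF_param ⟨h, hx.2⟩).monotoneOn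

theorem strictMonoOn_update_param {x : ℝ} (hx : x ∈ Ioc (0 : ℝ) 1) :
    StrictMonoOn (fun ε => update (C.deF φ) C.deG x ε) (Icc 0 1) :=
  -- `deG` ignores its second argument, so the parameter `0` stands for any other.
  H.strictMonoOn_deF_param (deG_mem_Ioc H.rate_pos 0 hx)

theorem continuousOn_update {ε : ℝ} (hε : ε ∈ Icc (0 : ℝ) 1) :
    ContinuousOn (fun x => update (C.deF φ) C.deG x ε) (Icc 0 1) :=
  (H.continuousOn_deF hε).comp (continuous_deG ε).continuousOn (mapsTo_deG H.rate_pos ε)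

theorem continuousOn_potential {ε : ℝ} (hε : ε ∈ Icc (0 : ℝ) 1) :
    ContinuousOn (fun x => potential (C.deF φ) C.deG x ε) (Icc 0 1) :=
  SpatialCoupling.continuousOn_potential (H.continuousOn_deF hε) (continuous_deG ε).continuousOn
    (mapsTo_deG H.rate_pos ε)

theorem intervalIntegrable_deF {ε : ℝ} (hε : ε ∈ Icc (0 : ℝ) 1) {y : ℝ} (hy : y ∈ Icc (0 : ℝ) 1) :
    IntervalIntegrable (fun z => C.deF φ z ε) MeasureTheory.volume 0 y :=
  ((H.continuousOn_deF hε).mono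
    (by rw [uIcc_of_le hy.1]; exact Icc_subset_Icc_right hy.2)).intervalIntegrable

theorem antitoneOn_potential_param {x : ℝ} (hx : x ∈ Icc (0 : ℝ) 1) :
    AntitoneOn (fun ε => potential (C.deF φ) C.deG x ε) (Icc 0 1) := by
  intro a ha b hb hab
  have hg := mapsTo_deG H.rate_pos 0 hx
  refine sub_le_sub_left (intervalIntegral.integral_mono_on hg.1 (H.intervalIntegrable_deF ha hg)
    (H.intervalIntegrable_deF hb hg) fun z hz => ?_) _
  exact H.monotoneOn_deF_param ⟨hz.1, hz.2.trans hg.2⟩ ha hb hab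

/-- The potential depends continuously on the parameter, uniformly on `[0, 1]`. -/
theorem exists_abs_potential_sub_le {η : ℝ} (hη : 0 < η) :
    ∃ d > 0, ∀ a ∈ Icc (0 : ℝ) 1, ∀ b ∈ Icc (0 : ℝ) 1, |a - b| < d → ∀ x ∈ Icc (0 : ℝ) 1,
      |potential (C.deF φ) C.deG x a - potential (C.deF φ) C.deG x b| ≤ η := by
  have huc := (isCompact_Icc.prod isCompact_Icc).uniformContinuousOn_of_continuous
    H.continuousOn_deF_prod
  obtain ⟨d, hd, h⟩ := Metric.uniformContinuousOn_iff.1 huc η hη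
  refine ⟨d, hd, fun a ha b hb hab x hx => ?_⟩
  have hg := mapsTo_deG H.rate_pos 0 hx
  -- The parameter enters only through the integral of f, over an interval of length at most 1.
  have heq : potential (C.deF φ) C.deG x a - potential (C.deF φ) C.deG x b =
      ∫ z in (0 : ℝ)..C.deG x 0, (C.deF φ z b - C.deF φ z a) := by
    rw [intervalIntegral.integral_sub (H.intervalIntegrable_deF hb hg)
      (H.intervalIntegrable_deF ha hg)]
    simp only [potential, deG]
    ring
  have hn := intervalIntegral.norm_integral_le_of_norm_le_const (a := 0) (b := C.deG x 0) (C := η)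
    (f := fun z => C.deF φ z b - C.deF φ z a) fun z hz => by
      rw [uIoc_of_le hg.1] at hz
      have hz' : z ∈ Icc (0 : ℝ) 1 := ⟨hz.1.le, hz.2.trans hg.2⟩
      have := h (z, b) ⟨hz', hb⟩ (z, a) ⟨hz', ha⟩
        (by rw [Prod.dist_eq, dist_self, Real.dist_eq, abs_sub_comm]; simpa [hd] using hab)
      exact this.le
  rw [heq, ← Real.norm_eq_abs]
  refine hn.trans ?_
  rw [sub_zero, abs_of_nonneg hg.1]
  exact mul_le_of_le_one_right hη.le hg.2

theorem hasDerivAt_potential {ε : ℝ} (hε : ε ∈ Icc (0 : ℝ) 1) {x : ℝ} (hx : x ∈ Ioo (0 : ℝ) 1) :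
    HasDerivAt (fun x => potential (C.deF φ) C.deG x ε) ((x - update (C.deF φ) C.deG x ε) *
      (C.R.derivative.derivative.eval (1 - x) / C.avgR)) x :=
  SpatialCoupling.hasDerivAt_potential (H.continuousOn_deF hε) (continuous_deG ε).continuousOn hx
    (deG_mem_Ioo H.rate_pos ε hx) (hasDerivAt_deG x ε)

theorem potential_lt_of_update_lt {ε : ℝ} (hε : ε ∈ Icc (0 : ℝ) 1) {a b : ℝ} (ha : 0 ≤ a)
    (hab : a < b) (hb : b ≤ 1) (h : ∀ x ∈ Ioo a b, update (C.deF φ) C.deG x ε < x) :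
    potential (C.deF φ) C.deG a ε < potential (C.deF φ) C.deG b ε := by
  refine strictMonoOn_of_deriv_pos (convex_Icc a b)
    ((H.continuousOn_potential hε).mono (Icc_subset_Icc ha hb)) (fun x hx => ?_)
    (left_mem_Icc.2 hab.le) (right_mem_Icc.2 hab.le) hab
  rw [interior_Icc] at hx
  rw [(H.hasDerivAt_potential hε ⟨ha.trans_lt hx.1, hx.2.trans_le hb⟩).deriv]
  exact mul_pos (sub_pos.2 (h x hx)) (derivative_deG_pos H.rate_pos (hx.2.trans_le hb))

theorem potential_lt_of_lt_update {ε : ℝ} (hε : ε ∈ Icc (0 : ℝ) 1) {a b : ℝ} (ha : 0 ≤ a)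
    (hab : a < b) (hb : b ≤ 1) (h : ∀ x ∈ Ioo a b, x < update (C.deF φ) C.deG x ε) :
    potential (C.deF φ) C.deG b ε < potential (C.deF φ) C.deG a ε := by
  refine strictAntiOn_of_deriv_neg (convex_Icc a b)
    ((H.continuousOn_potential hε).mono (Icc_subset_Icc ha hb)) (fun x hx => ?_)
    (left_mem_Icc.2 hab.le) (right_mem_Icc.2 hab.le) hab
  rw [interior_Icc] at hx
  rw [(H.hasDerivAt_potential hε ⟨ha.trans_lt hx.1, hx.2.trans_le hb⟩).deriv]
  exact mul_neg_of_neg_of_pos (sub_neg.2 (h x hx))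
    (derivative_deG_pos H.rate_pos (hx.2.trans_le hb))

/-- A positive minimizer of the potential is a fixed point of the update. -/
theorem update_eq_of_isMinOn_potential {ε : ℝ} (hε : ε ∈ Icc (0 : ℝ) 1) {x : ℝ}
    (hx : x ∈ Ioc (0 : ℝ) 1)
    (hmin : IsMinOn (fun x => potential (C.deF φ) C.deG x ε) (Icc 0 1) x) :
    update (C.deF φ) C.deG x ε = x := by
  have hx' : x ∈ Icc (0 : ℝ) 1 := ⟨hx.1.le, hx.2⟩
  have hcont := H.continuousOn_update hε
  rcases lt_trichotomy (update (C.deF φ) C.deG x ε) x with hlt | heq | hgt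
  · have hev : ∀ᶠ y in 𝓝[Icc 0 1] x, update (C.deF φ) C.deG y ε < y :=
      (hcont x hx').eventually_lt continuousWithinAt_id hlt
    have hev' : ∀ᶠ y in 𝓝[<] x, update (C.deF φ) C.deG y ε < y := by
      rw [eventually_nhdsWithin_iff] at hev
      filter_upwards [hev.filter_mono nhdsWithin_le_nhds, Ioo_mem_nhdsLT hx.1] with y hy hy'
      exact hy ⟨hy'.1.le, hy'.2.le.trans hx.2⟩
    obtain ⟨a, ha, hsub⟩ := (mem_nhdsLT_iff_exists_mem_Ico_Ioo_subset hx.1).1 hev'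
    have := H.potential_lt_of_update_lt hε ha.1 ha.2 hx.2 fun y hy => hsub hy
    exact absurd (hmin ⟨ha.1, ha.2.le.trans hx.2⟩) this.not_ge
  · exact heq
  -- Since h ≤ 1, the case h(x) > x excludes the endpoint 1, which leaves room to move right and
  -- lower U.
  · have hx1 : x < 1 := hgt.trans_le (H.mapsTo_deF hε (mapsTo_deG H.rate_pos ε hx')).2
    have hev : ∀ᶠ y in 𝓝[Icc 0 1] x, y < update (C.deF φ) C.deG y ε :=
      continuousWithinAt_id.eventually_lt (hcont x hx') hgt
    have hev' : ∀ᶠ y in 𝓝[>] x, y < update (C.deF φ) C.deG y ε := by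
      rw [eventually_nhdsWithin_iff] at hev
      filter_upwards [hev.filter_mono nhdsWithin_le_nhds, Ioo_mem_nhdsGT hx1] with y hy hy'
      exact hy ⟨hx.1.le.trans hy'.1.le, hy'.2.le⟩
    obtain ⟨b, hb, hsub⟩ := (mem_nhdsGT_iff_exists_mem_Ioc_Ioo_subset hx1).1 hev'
    have := H.potential_lt_of_lt_update hε hx.1.le hb.1 hb.2 fun y hy => hsub hy
    exact absurd (hmin ⟨hx.1.le.trans hb.1.le, hb.2⟩) this.not_ge

/-- Strict monotonicity in ε leaves one admissible parameter, so the infimum is over a singleton. -/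
theorem fixedPointParam_eq {ε x : ℝ} (hε : ε ∈ Icc (0 : ℝ) 1) (hx : x ∈ Ioc (0 : ℝ) 1)
    (h : update (C.deF φ) C.deG x ε = x) : fixedPointParam (C.deF φ) C.deG x = ε := by
  have : {e | e ∈ Icc (0 : ℝ) 1 ∧ update (C.deF φ) C.deG x e = x} = {ε} := by
    ext e
    refine ⟨fun he => ?_, fun he => ?_⟩
    · exact (H.strictMonoOn_update_param hx).injOn he.1 hε (he.2.trans h.symm)
    · rw [mem_singleton_iff.1 he]
      exact ⟨hε, h⟩
  rw [fixedPointParam, this, csInf_singleton]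

theorem fixedPointParam_mem_Icc {x : ℝ} (hx : x ∈ fixedPointSupport (C.deF φ) C.deG) :
    fixedPointParam (C.deF φ) C.deG x ∈ Icc (0 : ℝ) 1 := by
  have hx' : x ∈ Icc (0 : ℝ) 1 := ⟨hx.1.1.le, hx.1.2⟩
  obtain ⟨e, he, hex⟩ := intermediate_value_Icc (zero_le_one (α := ℝ))
    (H.continuousOn_deF_param (mapsTo_deG H.rate_pos 0 hx')) hx.2
  rw [H.fixedPointParam_eq he hx.1 hex]
  exact he

theorem maxMinimizer_eq_zero_iff {ε : ℝ} (hε : ε ∈ Icc (0 : ℝ) 1) :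
    maxMinimizer (C.deF φ) C.deG ε = 0 ↔
      ∀ x ∈ Ioc (0 : ℝ) 1, 0 < potential (C.deF φ) C.deG x ε :=
  SpatialCoupling.maxMinimizer_eq_zero_iff (H.continuousOn_potential hε) (deG_zero H.rate_pos ε)

theorem stableAtZero_of_le {a b : ℝ} (ha : a ∈ Icc (0 : ℝ) 1) (hb : b ∈ Icc (0 : ℝ) 1)
    (hab : a ≤ b) (h : StableAtZero (C.deF φ) C.deG b) : StableAtZero (C.deF φ) C.deG a := by
  obtain ⟨δ, hδ, hst⟩ := h
  exact ⟨δ, hδ, fun x hx => ((H.strictMonoOn_update_param ⟨hx.1, hx.2.trans hδ.2⟩).monotoneOn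
    ha hb hab).trans_lt (hst x hx)⟩

end Admissible
end LDPCEnsemble
end SpatialCoupling

/-! ### Instability at zero. -/

namespace SpatialCoupling
namespace LDPCEnsemble
namespace Admissible

variable {C : LDPCEnsemble} {φ : ℝ → ℝ → ℝ} (H : C.Admissible φ)
include H

theorem tendsto_deG_nhdsGT_zero (ε : ℝ) :
    Tendsto (fun x => C.deG x ε) (𝓝[>] 0) (𝓝[>] 0) := by
  refine tendsto_nhdsWithin_iff.2 ⟨?_, ?_⟩
  · have := (continuous_deG (C := C) ε).tendsto 0
    rw [deG_zero H.rate_pos] at this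
    exact this.mono_left nhdsWithin_le_nhds
  · filter_upwards [Ioo_mem_nhdsGT zero_lt_one] with x hx
    exact (deG_mem_Ioo H.rate_pos ε hx).1

omit H in
theorem tendsto_L_eval_nhdsGT_zero : Tendsto (fun x => C.L.eval x) (𝓝[>] 0) (𝓝[>] 0) := by
  refine tendsto_nhdsWithin_iff.2 ⟨?_, ?_⟩
  · have := C.L.continuous.tendsto 0
    rw [C.L_eval_zero] at this
    exact this.mono_left nhdsWithin_le_nhds
  · filter_upwards [self_mem_nhdsWithin] with x hx
    exact C.L_eval_pos hx

/-- If the erasure rates at two parameters are separated near `0` by a polynomial and `0` is not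
stable at the smaller parameter, then `0` is repelling at the larger one. -/
theorem eventually_lt_update_of_polynomial {a b : ℝ} (B : Polynomial ℝ)
    (hB : ∀ᶠ u in 𝓝[>] (0 : ℝ), φ u a < B.eval u ∧ B.eval u < φ u b)
    (ha : ¬ StableAtZero (C.deF φ) C.deG a) :
    ∀ᶠ x in 𝓝[>] (0 : ℝ), x < update (C.deF φ) C.deG x b := by
  have hfreq : ∃ᶠ x in 𝓝[>] (0 : ℝ), x ≤ update (C.deF φ) C.deG x a := by
    intro hev
    obtain ⟨u, hu, hsub⟩ := mem_nhdsGT_iff_exists_Ioc_subset.1 hev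
    exact ha ⟨min u 1, ⟨lt_min hu zero_lt_one, min_le_right _ _⟩, fun x hx =>
      not_le.1 (hsub ⟨hx.1, hx.2.trans (min_le_left _ _)⟩)⟩
  -- `P` is h(x) - x with φ replaced by `B`. It exceeds h(x;a) - x, which is nonnegative frequently,
  -- and stays below h(x;b) - x; its constant sign upgrades "frequently" to "eventually".
  set G : Polynomial ℝ := 1 - Polynomial.C (C.avgR⁻¹) * C.R.derivative.comp (1 - Polynomial.X)
  set P : Polynomial ℝ := (B.comp C.L * (Polynomial.C (C.avgL⁻¹) * C.L.derivative)).comp G -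
    Polynomial.X with hP
  have hG : ∀ x, G.eval x = C.deG x 0 := fun x => by
    simp [G, deG, edgeR, div_eq_inv_mul]
  have hPx : ∀ x, P.eval x =
      B.eval (C.L.eval (C.deG x 0)) * C.edgeL (C.deG x 0) - x := fun x => by
    simp [hP, hG, edgeL, div_eq_inv_mul]
  have hev := ((tendsto_L_eval_nhdsGT_zero (C := C)).comp (H.tendsto_deG_nhdsGT_zero 0)).eventually hB
  have hpos : ∀ᶠ x in 𝓝[>] (0 : ℝ), 0 < C.edgeL (C.deG x 0) := by
    filter_upwards [(H.tendsto_deG_nhdsGT_zero 0).eventually self_mem_nhdsWithin] with x hx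
    exact C.edgeL_pos hx
  have hPf : ∃ᶠ x in 𝓝[>] (0 : ℝ), 0 < P.eval x := by
    refine (hfreq.and_eventually (hev.and hpos)).mono fun x hx => ?_
    rw [hPx, sub_pos]
    exact hx.1.trans_lt (mul_lt_mul_of_pos_right hx.2.1.1 hx.2.2)
  filter_upwards [eventually_eval_pos_of_frequently hPf, hev, hpos] with x h1 h2 h3
  rw [hPx, sub_pos] at h1
  exact h1.trans (mul_lt_mul_of_pos_right h2.2 h3)

theorem tendsto_nhdsGT_zero {ε : ℝ} (hε : ε ∈ Icc (0 : ℝ) 1) :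
    Tendsto (fun u => φ u ε) (𝓝[>] 0) (𝓝 (φ 0 ε)) := by
  have h : ContinuousOn (fun u => φ u ε) (Icc 0 1) :=
    H.continuousOn.comp (f := fun u => (u, ε)) (by fun_prop) fun _ hu => ⟨hu, hε⟩
  have h0 := (h 0 (by simp)).tendsto
  rw [nhdsWithin_Icc_eq_nhdsGE zero_lt_one] at h0
  exact h0.mono_left (nhdsWithin_mono _ Ioi_subset_Ici_self)

/-- Strict monotonicity is available only for positive first argument; the weak inequality survives
in the limit. -/
theorem apply_zero_le {a b : ℝ} (ha : a ∈ Icc (0 : ℝ) 1) (hb : b ∈ Icc (0 : ℝ) 1) (hab : a < b) :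
    φ 0 a ≤ φ 0 b := by
  refine le_of_tendsto_of_tendsto (H.tendsto_nhdsGT_zero ha) (H.tendsto_nhdsGT_zero hb) ?_
  filter_upwards [Ioo_mem_nhdsGT zero_lt_one] with u hu
  exact (H.strictMonoOn u ⟨hu.1, hu.2.le⟩ ha hb hab).le

/-- The separating polynomial is a constant between φ(0;a) and φ(0;b), or, when the derivatives at 0
differ, the line through φ(0;a) with the mean slope. An expansion error of a quarter of the slope
gap is less than the half gap on each side. -/
theorem eventually_lt_update (hdiff : ∀ ε ∈ Icc (0 : ℝ) 1,
      DifferentiableWithinAt ℝ (fun x => φ x ε) (Icc 0 1) 0)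
    (h_zero : StrictMonoOn (fun ε => derivWithin (fun x => φ x ε) (Icc 0 1) 0) (Icc 0 1) ∨
      StrictMonoOn (fun ε => φ 0 ε) (Icc 0 1))
    {a b : ℝ} (ha : a ∈ Icc (0 : ℝ) 1) (hb : b ∈ Icc (0 : ℝ) 1) (hab : a < b)
    (hst : ¬ StableAtZero (C.deF φ) C.deG a) :
    ∀ᶠ x in 𝓝[>] (0 : ℝ), x < update (C.deF φ) C.deG x b := by
  rcases h_zero with h | h
  · set D := fun ε => derivWithin (fun x => φ x ε) (Icc 0 1) 0
    have hD : D a < D b := h ha hb hab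
    have hexp : ∀ ε ∈ Icc (0 : ℝ) 1, ∀ᶠ u in 𝓝[>] (0 : ℝ),
        |φ u ε - φ 0 ε - u * D ε| ≤ (D b - D a) / 4 * |u| := by
      intro ε hε
      have h1 := (hasDerivWithinAt_iff_isLittleO.1 (hdiff ε hε).hasDerivWithinAt).def
        (show 0 < (D b - D a) / 4 by linarith)
      rw [nhdsWithin_Icc_eq_nhdsGE zero_lt_one] at h1
      have h2 := h1.filter_mono (nhdsWithin_mono _ Ioi_subset_Ici_self)
      simpa [Real.norm_eq_abs] using h2
    refine H.eventually_lt_update_of_polynomial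
      (Polynomial.C (φ 0 a) + Polynomial.C ((D a + D b) / 2) * Polynomial.X) ?_ hst
    filter_upwards [hexp a ha, hexp b hb, self_mem_nhdsWithin] with u hua hub hu
    have hu : 0 < u := hu
    have h0 := H.apply_zero_le ha hb hab
    have hpos : 0 < (D b - D a) * u := mul_pos (sub_pos.2 hD) hu
    rw [abs_of_pos hu] at hua hub
    have h1 := (abs_le.1 hua).2
    have h2 := (abs_le.1 hub).1
    simp only [Polynomial.eval_add, Polynomial.eval_mul, Polynomial.eval_C, Polynomial.eval_X]
    constructor <;> linarith
  · have h0 : φ 0 a < φ 0 b := h ha hb hab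
    obtain ⟨c, hac, hcb⟩ := exists_between h0
    refine H.eventually_lt_update_of_polynomial (Polynomial.C c) ?_ hst
    simp only [Polynomial.eval_C]
    exact ((H.tendsto_nhdsGT_zero ha).eventually_lt_const hac).and
      ((H.tendsto_nhdsGT_zero hb).eventually_const_lt hcb)

/-! ### Comparison of the potential, stability and Maxwell thresholds. -/

theorem maxMinimizer_eq_zero_of_lt_potentialThreshold {ε : ℝ} (hε : ε ∈ Icc (0 : ℝ) 1)
    (h_pot : maxMinimizer (C.deF φ) C.deG 0 = 0)
    (h : ε < potentialThreshold (C.deF φ) C.deG) : maxMinimizer (C.deF φ) C.deG ε = 0 := by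
  -- Some `e > ε` has positive potential on (0,1], and positivity passes down to ε because U
  -- decreases in the parameter.
  obtain ⟨e, ⟨he, hme⟩, hlt⟩ := exists_lt_of_lt_csSup
    (s := {ε | ε ∈ Icc (0 : ℝ) 1 ∧ maxMinimizer (C.deF φ) C.deG ε = 0})
    ⟨0, by simp, h_pot⟩ h
  rw [H.maxMinimizer_eq_zero_iff hε]
  rw [H.maxMinimizer_eq_zero_iff he] at hme
  exact fun x hx => (hme x hx).trans_le
    (H.antitoneOn_potential_param ⟨hx.1.le, hx.2⟩ hε he hlt.le)

theorem stableAtZero_of_lt_stabilityThreshold {ε : ℝ} (hε : ε ∈ Icc (0 : ℝ) 1)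
    (h_stab : StableAtZero (C.deF φ) C.deG 0)
    (h : ε < stabilityThreshold (C.deF φ) C.deG) : StableAtZero (C.deF φ) C.deG ε := by
  obtain ⟨e, ⟨he, hse⟩, hlt⟩ := exists_lt_of_lt_csSup
    (s := {ε | ε ∈ Icc (0 : ℝ) 1 ∧ StableAtZero (C.deF φ) C.deG ε})
    ⟨0, by simp, h_stab⟩ h
  exact H.stableAtZero_of_le hε he hlt.le hse

omit H in
theorem bddAbove_sep_Icc (p : ℝ → Prop) : BddAbove {ε | ε ∈ Icc (0 : ℝ) 1 ∧ p ε} :=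
  ⟨1, fun _ h => h.1.2⟩

omit H in
theorem potentialThreshold_mem_Icc (h_pot : maxMinimizer (C.deF φ) C.deG 0 = 0) :
    potentialThreshold (C.deF φ) C.deG ∈ Icc (0 : ℝ) 1 :=
  ⟨le_csSup (bddAbove_sep_Icc _) ⟨by simp, h_pot⟩,
    csSup_le ⟨0, by simp, h_pot⟩ fun _ h => h.1.2⟩

/-- If some b > ε_stab had 0 as largest minimizer, instability at an a strictly between would give
h(x;b) > x near 0, so U(·;b) would drop below U(0) = 0. -/
theorem potentialThreshold_le_stabilityThreshold (hdiff : ∀ ε ∈ Icc (0 : ℝ) 1,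
      DifferentiableWithinAt ℝ (fun x => φ x ε) (Icc 0 1) 0)
    (h_zero : StrictMonoOn (fun ε => derivWithin (fun x => φ x ε) (Icc 0 1) 0) (Icc 0 1) ∨
      StrictMonoOn (fun ε => φ 0 ε) (Icc 0 1))
    (h_pot : maxMinimizer (C.deF φ) C.deG 0 = 0) (h_stab : StableAtZero (C.deF φ) C.deG 0) :
    potentialThreshold (C.deF φ) C.deG ≤ stabilityThreshold (C.deF φ) C.deG := by
  refine csSup_le ⟨0, by simp, h_pot⟩ fun b hb => ?_
  by_contra! hlt
  obtain ⟨a, hsa, hab⟩ := exists_between hlt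
  have h0 : 0 ≤ stabilityThreshold (C.deF φ) C.deG :=
    le_csSup (bddAbove_sep_Icc _) ⟨by simp, h_stab⟩
  have ha : a ∈ Icc (0 : ℝ) 1 := ⟨h0.trans hsa.le, hab.le.trans hb.1.2⟩
  have hns : ¬ StableAtZero (C.deF φ) C.deG a := fun h =>
    hsa.not_ge (le_csSup (bddAbove_sep_Icc _) ⟨ha, h⟩)
  obtain ⟨x, hx, hsub⟩ := (mem_nhdsGT_iff_exists_mem_Ioc_Ioo_subset zero_lt_one).1
    (H.eventually_lt_update hdiff h_zero ha hb.1 hab hns)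
  have := H.potential_lt_of_lt_update hb.1 le_rfl hx.1 hx.2 fun y hy => hsub hy
  rw [potential_zero (deG_zero H.rate_pos b)] at this
  exact this.not_gt ((H.maxMinimizer_eq_zero_iff hb.1).1 hb.2 x hx)

/-- Below the stability threshold, the potential threshold is attained as `ε(x)` for a positive
minimizer `x` of the potential with vanishing trial entropy. -/
theorem exists_fixedPointParam_eq_potentialThreshold
    (h_pot : maxMinimizer (C.deF φ) C.deG 0 = 0) (h_stab : StableAtZero (C.deF φ) C.deG 0)
    (hlt : potentialThreshold (C.deF φ) C.deG < stabilityThreshold (C.deF φ) C.deG) :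
    ∃ x ∈ fixedPointSupport (C.deF φ) C.deG, C.trialEntropy φ x = 0 ∧
      potentialThreshold (C.deF φ) C.deG = fixedPointParam (C.deF φ) C.deG x := by
  have hc := potentialThreshold_mem_Icc h_pot
  set c := potentialThreshold (C.deF φ) C.deG with hcdef
  obtain ⟨e, ⟨he, δ, hδ, hst⟩, hce⟩ := exists_lt_of_lt_csSup
    (s := {ε | ε ∈ Icc (0 : ℝ) 1 ∧ StableAtZero (C.deF φ) C.deG ε})
    ⟨0, by simp, h_stab⟩ hlt
  -- Stability at the single parameter `e` beyond c gives one δ that works for every ε ≤ e.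
  have hnear : ∀ ε ∈ Icc (0 : ℝ) 1, ε ≤ e → ∀ x ∈ Ioc (0 : ℝ) δ,
      0 < potential (C.deF φ) C.deG x ε := by
    intro ε hε hεe x hx
    have h1 := H.potential_lt_of_update_lt he le_rfl hx.1 (hx.2.trans hδ.2)
      fun y hy => hst y ⟨hy.1, hy.2.le.trans hx.2⟩
    rw [potential_zero (deG_zero H.rate_pos e)] at h1
    exact h1.trans_le (H.antitoneOn_potential_param ⟨hx.1.le, hx.2.trans hδ.2⟩ hε he hεe)
  -- Uniform continuity in ε passes positivity at parameters just below c to the limit.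
  have hnonneg : ∀ x ∈ Icc (0 : ℝ) 1, 0 ≤ potential (C.deF φ) C.deG x c := by
    intro x hx
    by_contra! hneg
    obtain ⟨d, hd, hunif⟩ := H.exists_abs_potential_sub_le
      (show 0 < -potential (C.deF φ) C.deG x c / 2 by linarith)
    obtain ⟨b, hb, hcb⟩ := exists_lt_of_lt_csSup
      (s := {ε | ε ∈ Icc (0 : ℝ) 1 ∧ maxMinimizer (C.deF φ) C.deG ε = 0})
      ⟨0, by simp, h_pot⟩ (show c - d < _ from sub_lt_self c hd)
    have hbc : b ≤ c := le_csSup (bddAbove_sep_Icc _) hb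
    have h1 := (abs_le.1 (hunif b hb.1 c hc (by rw [abs_sub_lt_iff]; constructor <;> linarith)
      x hx)).2
    rcases hx.1.eq_or_lt with rfl | hx0
    · rw [potential_zero (deG_zero H.rate_pos c)] at hneg
      exact hneg.false
    · have := (H.maxMinimizer_eq_zero_iff hb.1).1 hb.2 x ⟨hx0, hx.2⟩
      linarith
  obtain ⟨m, hm, hmin⟩ := isCompact_Icc.exists_isMinOn (nonempty_Icc.2 hδ.2)
    ((H.continuousOn_potential hc).mono (Icc_subset_Icc_left hδ.1.le))
  have hm' : m ∈ Ioc (0 : ℝ) 1 := ⟨hδ.1.trans_le hm.1, hm.2⟩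
  -- A positive minimum on [δ,1] would persist for parameters slightly above c; with `hnear` on
  -- (0,δ] this contradicts c being the supremum. Hence `b` is taken below both `e` and `c + d`.
  have hm0 : potential (C.deF φ) C.deG m c = 0 := by
    refine le_antisymm ?_ (hnonneg m ⟨hm'.1.le, hm'.2⟩)
    by_contra! hpos
    obtain ⟨d, hd, hunif⟩ := H.exists_abs_potential_sub_le
      (show 0 < potential (C.deF φ) C.deG m c / 2 by linarith)
    obtain ⟨b, hcb, hb⟩ := exists_between (lt_min hce (lt_add_of_pos_right c hd))
    have hbe := (lt_min_iff.1 hb).1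
    have hbd := (lt_min_iff.1 hb).2
    have hbI : b ∈ Icc (0 : ℝ) 1 := ⟨hc.1.trans hcb.le, hbe.le.trans he.2⟩
    refine hcb.not_ge (le_csSup (bddAbove_sep_Icc _)
      ⟨hbI, (H.maxMinimizer_eq_zero_iff hbI).2 fun x hx => ?_⟩)
    rcases le_total x δ with hxδ | hxδ
    · exact hnear b hbI hbe.le x ⟨hx.1, hxδ⟩
    · have h1 := (abs_le.1 (hunif b hbI c hc (by rw [abs_sub_lt_iff]; constructor <;> linarith)
        x ⟨hx.1.le, hx.2⟩)).1
      have h2 : potential (C.deF φ) C.deG m c ≤ potential (C.deF φ) C.deG x c :=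
        hmin ⟨hxδ, hx.2⟩
      linarith
  -- `m` minimizes over all of [0,1], since U ≥ 0 = U(m) there.
  have hfix := H.update_eq_of_isMinOn_potential hc hm' fun x hx => by
    show potential _ _ m c ≤ potential _ _ x c
    rw [hm0]
    exact hnonneg x hx
  have hparam := H.fixedPointParam_eq hc hm' hfix
  have hup := (H.strictMonoOn_update_param hm').monotoneOn
  refine ⟨m, ⟨hm', ?_, ?_⟩, ?_, hparam.symm⟩
  · exact (hup (by simp) hc hc.1).trans hfix.le
  · exact hfix.ge.trans (hup hc (by simp) hc.2)
  · rw [trialEntropy, fixedPointPotential, hparam, hm0, mul_zero]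

/-- The potential threshold is the minimum that defines the generalized Maxwell threshold. -/
theorem isLeast_maxwellValues_potentialThreshold (hdiff : ∀ ε ∈ Icc (0 : ℝ) 1,
      DifferentiableWithinAt ℝ (fun x => φ x ε) (Icc 0 1) 0)
    (h_zero : StrictMonoOn (fun ε => derivWithin (fun x => φ x ε) (Icc 0 1) 0) (Icc 0 1) ∨
      StrictMonoOn (fun ε => φ 0 ε) (Icc 0 1))
    (h_pot : maxMinimizer (C.deF φ) C.deG 0 = 0) (h_stab : StableAtZero (C.deF φ) C.deG 0) :
    IsLeast (C.maxwellValues φ) (potentialThreshold (C.deF φ) C.deG) := by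
  have hle := H.potentialThreshold_le_stabilityThreshold hdiff h_zero h_pot h_stab
  constructor
  · rcases hle.eq_or_lt with heq | hlt
    · exact Or.inl heq
    · exact Or.inr (H.exists_fixedPointParam_eq_potentialThreshold h_pot h_stab hlt)
  · rintro _ (rfl | ⟨x, hx, hP, rfl⟩)
    · exact hle
    -- Below the potential threshold U(x;ε(x)) > 0, so x cannot be a root of the trial entropy.
    · by_contra! hlt
      have hε := H.fixedPointParam_mem_Icc hx
      have hpos := (H.maxMinimizer_eq_zero_iff hε).1
        (H.maxMinimizer_eq_zero_of_lt_potentialThreshold hε h_pot hlt) x hx.1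
      rcases mul_eq_zero.1 hP with h | h
      · exact C.avgL_pos.ne' (neg_eq_zero.1 h)
      · exact hpos.ne' h

end Admissible
end LDPCEnsemble
end SpatialCoupling

/-! ### The main theorem. -/

theorem mainTheorem8 (C : SpatialCoupling.LDPCEnsemble) (φ : ℝ → ℝ → ℝ)
    (h_rate : 0 < C.rate)
    (h_range : ∀ x ∈ Set.Icc (0 : ℝ) 1, ∀ ε ∈ Set.Icc (0 : ℝ) 1, φ x ε ∈ Set.Icc (0 : ℝ) 1)
    (h_smooth : ContDiffOn ℝ 1 (fun p : ℝ × ℝ => φ p.1 p.2)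
      (Set.Icc (0 : ℝ) 1 ×ˢ Set.Icc (0 : ℝ) 1))
    (h_mono : ∀ ε ∈ Set.Icc (0 : ℝ) 1, MonotoneOn (fun x => C.deF φ x ε) (Set.Icc 0 1))
    (h_strict : ∀ x ∈ Set.Ioc (0 : ℝ) 1, StrictMonoOn (fun ε => φ x ε) (Set.Icc 0 1))
    (h_zero : StrictMonoOn (fun ε => derivWithin (fun x => φ x ε) (Set.Icc 0 1) 0) (Set.Icc 0 1) ∨
      StrictMonoOn (fun ε => φ 0 ε) (Set.Icc 0 1))
    (h_one : φ 1 1 = 1)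
    (h_pot : SpatialCoupling.maxMinimizer (C.deF φ) C.deG 0 = 0)
    (h_stab : SpatialCoupling.StableAtZero (C.deF φ) C.deG 0) :
    IsLeast (C.maxwellValues φ) (C.maxwellThreshold φ) ∧
    SpatialCoupling.potentialThreshold (C.deF φ) C.deG = C.maxwellThreshold φ ∧
    ∀ ε ∈ Set.Icc (0 : ℝ) 1, ε < C.maxwellThreshold φ →
      ∃ w₀ : ℕ, ∀ w > w₀, ∀ N ≥ 1, ∀ i : Fin (N + w - 1),
        Filter.Tendsto
          (fun l : ℕ => SpatialCoupling.coupledSeq (C.deF φ) C.deG ε N w l i)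
          Filter.atTop (nhds 0) := by
  have H : C.Admissible φ := ⟨h_rate, h_range, h_smooth.continuousOn, h_mono, h_strict⟩
  have hdiff : ∀ ε ∈ Icc (0 : ℝ) 1,
      DifferentiableWithinAt ℝ (fun x => φ x ε) (Icc 0 1) 0 := by
    intro ε hε
    have h := h_smooth.differentiableOn one_ne_zero (0, ε) ⟨by simp, hε⟩
    exact h.comp (f := fun x : ℝ => (x, ε)) 0 (by fun_prop) fun x hx => ⟨hx, hε⟩
  have hleast := H.isLeast_maxwellValues_potentialThreshold hdiff h_zero h_pot h_stab
  have heq : C.maxwellThreshold φ = SpatialCoupling.potentialThreshold (C.deF φ) C.deG :=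
    hleast.csInf_eq
  rw [heq]
  refine ⟨hleast, rfl, fun ε hε hlt => ?_⟩
  have hle := H.potentialThreshold_le_stabilityThreshold hdiff h_zero h_pot h_stab
  exact SpatialCoupling.exists_forall_tendsto_coupledSeq (h_mono ε hε) (H.mapsTo_deF hε)
    (H.continuousOn_deF hε) (SpatialCoupling.LDPCEnsemble.strictMonoOn_deG h_rate ε).monotoneOn
    (SpatialCoupling.LDPCEnsemble.mapsTo_deG h_rate ε)
    (SpatialCoupling.LDPCEnsemble.continuous_deG ε).continuousOn
    (H.stableAtZero_of_lt_stabilityThreshold hε h_stab (hlt.trans_le hle))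
    ((H.maxMinimizer_eq_zero_iff hε).1
      (H.maxMinimizer_eq_zero_of_lt_potentialThreshold hε h_pot hlt))
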